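/- **Network.** A cellular network consists of a finite set $\mathcal B$ of base stations (BSs), a finite set $\mathcal N$ of users, a graph $G_J=(\mathcal B,\mathcal C)$ of backhaul links, for each user $n$ a serving station $\mathrm{BS}(n)$ and at most one secondary station $\widehat{\mathrm{BS}}(n)$, adjacent to $\mathrm{BS}(n)$ in $G_J$, a number $S$ of scheduled blocks per subframe and BS, a capacity $K$ (packets per subframe) of each backhaul link, and success probabilities $p_{n,0},p_{n,1}\in[0,1]$ of single and joint transmission to user $n$, with $p_{n,0}\le p_{n,1}$ if $n$ has a secondary BS. Each user $n$ has a queue $Q_n$ of length $L_n$ and a queue $\widehat Q_n$ of packets available for joint transmission, of length $\widehat L_n$. For a packet $i$ let $n(i)$ be its user and $\beta(i)\in\{0,1\}$ its queue type ($0$: $Q_n$; $1$: $\widehat Q_n$); let $p(i)=p_{n(i),\beta(i)}$, $h(i)=\{\mathrm{BS}(n(i))\}$ if $\beta(i)=0$ and $h(i)=\{\mathrm{BS}(n(i)),\widehat{\mathrm{BS}}(n(i))\}$ if $\beta(i)=1$. **OJS.** Given the set $\mathcal I$ of packets present and a utility $u:\mathcal I\times\{0,1\}\to\mathbb R_+$,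 OJS is to maximize $\sum_i z_iu(i,1)+y_iu(i,0)$ over $z_i,y_i,x_{is}\in\{0,1\}$ subject to: $z_i+y_i\le1$ for all $i$; $\sum_{i:a\in h(i)}z_i\le S$ for every BS $a$; $\sum y_i\le K$ for every link $l\in\mathcal C$, the sum being over the packets with $\beta(i)=0$ and $\{\mathrm{BS}(n(i)),\widehat{\mathrm{BS}}(n(i))\}=l$; $\sum_{s=1}^Sx_{is}=z_i$ for all $i$; $y_i=0$ if $\beta(i)=1$; $\sum_{i:b\in h(i)}x_{is}\le1$ for every BS $b$ and block $s$; and, if $n(i)$ has no secondary BS, $y_i=0$, and $z_i=0$ if $\beta(i)=1$. **Dynamics.** A policy chooses in each subframe, as a (possibly randomized) function of the queue lengths, a feasible solution of OJS. Then $$L_n(t+1)=L_n(t)+W_n(t)-\mu^{(1)}_n(t)-\mu^{(3)}_n(t),\qquad \widehat L_n(t+1)=\widehat L_n(t)+\mu^{(3)}_n(t)-\mu_n^{(2)}(t),$$ where $\mu_n^{(1)}(t)=\sum z_iY_{it}$ over the packets of $Q_n$, $\mu_n^{(2)}(t)=\sum z_iY_{it}$ over those of $\widehat Q_n$, $\mu_n^{(3)}(t)=\sum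 y_i$ over those of $Q_n$, the $Y_{it}$ are Bernoulli with parameter $p(i)$, the arrival numbers $W_n(t)\in\mathbb N_0$ are i.i.d. over time, independent between users, with finite second moments and means $\lambda_n$, and all of these are independent. The queue-length process $\boldsymbol L(t)=(L_n(t),\widehat L_n(t))_{n}$ is a Markov chain. It is called stable from an initial state if, started there, it almost surely reaches a positive recurrent state, and positive recurrent (stable) if this holds from every initial state (for irreducible chains this is the usual notion). The stability region of a policy is the set of rate vectors $\boldsymbol\lambda$ for which (for some such arrival law with means $\boldsymbol\lambda$) the chain is positive recurrent; the capacity region is the union of the stability regions over all policies. **The policy $(\text{OJS-OPT},u_Q)$.** This is any policy that in each subframe solves OJS exactly for $$u_Q(i,0)=\max\{L_{n(i)}-\widehat L_{n(i)},0\},\qquad u_Q(i,1)=\begin{cases}L_{n(i)}\,p(i),&\beta(i)=0,\\ \widehat L_{n(i)}\,p(i),&\beta(i)=1,\end{cases}$$ with ties broken such that no packet of a user with $L_n<\widehat L_n$ is forwarded over the backhaul (this would have utility $0$). **The set $\Lambda$.** Let $R\subset\mathbb R_+^{3\mathcal N}$ be the set of the vectors $(r^{(1)}_n,r^{(2)}_n,r^{(3)}_n)_n$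 of expected values of $(\mu^{(1)}_n,\mu^{(2)}_n,\mu^{(3)}_n)_n$ over all feasible OJS solutions in saturation, i.e. with at least $S+K$ packets in each queue. Let $F_{\boldsymbol\lambda}$ be the set of $\boldsymbol f\in\mathbb R_+^{3\mathcal N}$ with $\lambda_n=f^{(1)}_n+f_n^{(3)}$ and $f_n^{(3)}=f_n^{(2)}$ for all $n$, and $$\Lambda=\big\{\boldsymbol\lambda\in\mathbb R_+^{\mathcal N}\ \big|\ \exists \boldsymbol f\in F_{\boldsymbol\lambda}\ \exists\boldsymbol r\in\mathrm{conv}(R):\ f_n^{(j)}<r_n^{(j)}\text{ whenever }f_n^{(j)}>0,\ n\in\mathcal N,\ j=1,2,3\big\}.$$ **Theorem.** Policies $(\text{OJS-OPT},u_Q)$ exist. If $\boldsymbol\lambda\in\Lambda$, then the queue-length process is positive recurrent under every policy $(\text{OJS-OPT},u_Q)$, for every arrival law with rate vector $\boldsymbol\lambda$. If $\boldsymbol\lambda\notin\overline\Lambda$, then under no policy is the queue-length process stable, for any arrival law with rate vector $\boldsymbol\lambda$ and from any initial state. Hence, up to boundary points, $\Lambda$ is the capacity region and $(\text{OJS-OPT},u_Q)$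 is throughput-optimal: $$\Lambda\ \subseteq\ \text{stability region of }(\text{OJS-OPT},u_Q)\ \subseteq\ \text{capacity region}\ \subseteq\ \overline\Lambda .$$ -/

import Mathlib

open MeasureTheory ProbabilityTheory Set

/-! ### Countable Markov chains -/

/-- For a transition function `P` on a countable space started in `x`, the probability that the
chain does not visit `A` at any of the times `1, …, n`. -/
noncomputable def avoidProb {X : Type*} (P : X → PMF X) (A : Set X) : ℕ → X → ENNReal
  | 0, _ => 1
  | n + 1, x => ∑' y, P x y * (Aᶜ).indicator (avoidProb P A n) y

/-- The state `x` is positive recurrent: the return time `τ = inf {n ≥ 1 | X n = x}` of the chain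
started in `x` satisfies `E τ = ∑ n, P (τ > n) < ∞`. -/
def IsPosRecState {X : Type*} (P : X → PMF X) (x : X) : Prop :=
  ∑' n, avoidProb P {x} n x < ⊤

/-- The chain started in `x` almost surely visits the set of positive recurrent states (the chain
need not be irreducible). The chain is positive recurrent if this holds for every `x`; for an
irreducible chain this is the usual notion. -/
def PosRecFrom {X : Type*} (P : X → PMF X) (x : X) : Prop :=
  ⨅ n, avoidProb P {y | IsPosRecState P y} n x = 0

/-- Positive recurrence of a chain: from every initial state it almost surely reaches the set of
positive recurrent states. -/
def IsPosRec {X : Type*} (P : X → PMF X) : Prop := ∀ x, PosRecFrom P x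

/-! ### The network -/

/-- A cellular network with base stations `V` and users `U`. -/
structure CellNetwork (V U : Type*) where
  /-- the joint transmission graph, whose edges are the backhaul links -/
  graph : SimpleGraph V
  /-- the serving base station of a user -/
  bs : U → V
  /-- the secondary base station of a user, if there is one -/
  sec : U → Option V
  /-- the secondary base station has a backhaul link to the serving one -/
  adj : ∀ n, ∀ b ∈ sec n, graph.Adj (bs n) b
  /-- the number of scheduled blocks per subframe and base station -/
  S : ℕ
  /-- the capacity of each backhaul link, in packets per subframe -/
  K : ℕ
  /-- `p n 0`, `p n 1`: the success probability of single and of joint transmission to user `n` -/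
  p : U → Fin 2 → unitInterval
  /-- joint transmission is at least as reliable as single transmission -/
  p_mono : ∀ n, (sec n).isSome → p n 0 ≤ p n 1

/-- The queue lengths: `q n 0` is the length of `Q_n` (packets at the serving base station) and
`q n 1` is the length of `Q̂_n` (packets available for joint transmission). -/
abbrev QueueState (U : Type*) := U → Fin 2 → ℕ

/-- The packets present in state `q`; a packet of user `n` in queue type `β` is `⟨(n, β), k⟩`. -/
abbrev Packet {U : Type*} (q : QueueState U) := Σ k : U × Fin 2, Fin (q k.1 k.2)

/-- The decision variables of one subframe with `S` scheduled blocks: `z i` (packet `i` is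
transmitted wirelessly), `y i` (packet `i` is forwarded over the backhaul), `x i s` (packet `i`
uses scheduled block `s`). -/
structure Schedule {U : Type*} (S : ℕ) (q : QueueState U) where
  z : Packet q → Bool
  y : Packet q → Bool
  x : Packet q → Fin S → Bool

namespace CellNetwork

variable {V U : Type*} [DecidableEq V] [Fintype U] [DecidableEq U]
set_option linter.unusedSectionVars false

/-- The set `h(i)` of base stations that take part in the wireless transmission of packet `i`. -/
def stations (N : CellNetwork V U) {q : QueueState U} (i : Packet q) : Finset V :=
  if i.1.2 = 0 then {N.bs i.1.1} else {N.bs i.1.1} ∪ (N.sec i.1.1).toFinset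

/-- The backhaul link between the serving and the secondary base station of user `n`. -/
def link (N : CellNetwork V U) (n : U) : Option (Sym2 V) :=
  (N.sec n).map fun b => s(N.bs n, b)

/-- The constraints of the OFDMA Joint Scheduling problem. -/
structure Feasible (N : CellNetwork V U) {q : QueueState U} (σ : Schedule N.S q) : Prop where
  one_conf : ∀ i, (σ.z i).toNat + (σ.y i).toNat ≤ 1
  subframe_cap : ∀ a, ∑ i with a ∈ N.stations i, (σ.z i).toNat ≤ N.S
  backhaul_cap : ∀ l ∈ N.graph.edgeSet,
    ∑ i : Packet q with i.1.2 = 0 ∧ N.link i.1.1 = some l, (σ.y i).toNat ≤ N.K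
  blocks : ∀ i, ∑ s, (σ.x i s).toNat = (σ.z i).toNat
  no_second_forward : ∀ i : Packet q, i.1.2 = 1 → σ.y i = false
  used_once : ∀ b s, ∑ i with b ∈ N.stations i, (σ.x i s).toNat ≤ 1
  /-- without a secondary base station there is neither forwarding nor joint transmission -/
  no_secondary_forward : ∀ i : Packet q, N.sec i.1.1 = none → σ.y i = false
  no_secondary_joint : ∀ i : Packet q, N.sec i.1.1 = none → i.1.2 = 1 → σ.z i = false

/-- The objective `∑ i, z i * u i 1 + y i * u i 0`. -/
noncomputable def objective (N : CellNetwork V U) {q : QueueState U}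
    (u : Packet q → Fin 2 → ℝ) (σ : Schedule N.S q) : ℝ :=
  ∑ i, (((σ.z i).toNat : ℝ) * u i 1 + ((σ.y i).toNat : ℝ) * u i 0)

/-- An exact solution of the OFDMA Joint Scheduling problem with utility `u`. -/
def IsOptimal (N : CellNetwork V U) {q : QueueState U}
    (u : Packet q → Fin 2 → ℝ) (σ : Schedule N.S q) : Prop :=
  N.Feasible σ ∧ ∀ σ' : Schedule N.S q, N.Feasible σ' → N.objective u σ' ≤ N.objective u σ

/-- The queue-length based utility: forwarding a packet of user `n` is worth
`max (L_n - L̂_n) 0`, and a wireless transmission is worth the success probability times the length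
of the queue that holds the packet. -/
noncomputable def utilityQ (N : CellNetwork V U) {q : QueueState U} (i : Packet q) (c : Fin 2) :
    ℝ :=
  if c = 0 then max ((q i.1.1 0 : ℝ) - q i.1.1 1) 0
  else (q i.1.1 i.1.2 : ℝ) * (N.p i.1.1 i.1.2 : ℝ)

/-! ### Queueing dynamics -/

/-- A (possibly randomized) scheduling policy: in each subframe it picks a feasible schedule, as a
function of the queue lengths. -/
structure Policy (N : CellNetwork V U) where
  law : (q : QueueState U) → PMF (Schedule N.S q)
  feasible : ∀ q, ∀ σ ∈ (law q).support, N.Feasible σ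

/-- `π` solves the OFDMA Joint Scheduling problem with utility `utilityQ` exactly in each subframe,
with ties broken such that no packet is forwarded from a shorter to a longer queue (such a move
has utility `0`). -/
def Policy.IsExactQ {N : CellNetwork V U} (π : N.Policy) : Prop :=
  ∀ q, ∀ σ ∈ (π.law q).support, N.IsOptimal N.utilityQ σ ∧
    ∀ i, σ.y i = true → q i.1.1 1 ≤ q i.1.1 0

/-- Packets that leave queue `β` of user `n` by a successful wireless transmission, where `Y i` says
whether a transmission of packet `i` succeeds. -/
def served (N : CellNetwork V U) {q : QueueState U} (σ : Schedule N.S q) (Y : Packet q → Bool)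
    (n : U) (β : Fin 2) : ℕ :=
  ∑ k : Fin (q n β), (σ.z ⟨(n, β), k⟩).toNat * (Y ⟨(n, β), k⟩).toNat

/-- Packets of user `n` forwarded over the backhaul. -/
def forwarded (N : CellNetwork V U) {q : QueueState U} (σ : Schedule N.S q) (n : U) : ℕ :=
  ∑ k : Fin (q n 0), (σ.y ⟨(n, 0), k⟩).toNat

/-- The queue lengths after a subframe with arrivals `W`. For a feasible schedule neither
subtraction truncates, see `served_add_forwarded_le` and `served_le`. -/
def next (N : CellNetwork V U) {q : QueueState U} (σ : Schedule N.S q) (Y : Packet q → Bool)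
    (W : U → ℕ) : QueueState U :=
  fun n => ![q n 0 - (N.served σ Y n 0 + N.forwarded σ n) + W n,
    q n 1 - N.served σ Y n 1 + N.forwarded σ n]

theorem served_le (N : CellNetwork V U) {q : QueueState U} (σ : Schedule N.S q)
    (Y : Packet q → Bool) (n : U) (β : Fin 2) : N.served σ Y n β ≤ q n β := by
  have h : N.served σ Y n β ≤ ∑ _k : Fin (q n β), 1 := by
    refine Finset.sum_le_sum fun k _ => ?_
    cases σ.z ⟨(n, β), k⟩ <;> cases Y ⟨(n, β), k⟩ <;> simp
  simpa using h

theorem served_add_forwarded_le (N : CellNetwork V U) {q : QueueState U} {σ : Schedule N.S q}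
    (hσ : N.Feasible σ) (Y : Packet q → Bool) (n : U) :
    N.served σ Y n 0 + N.forwarded σ n ≤ q n 0 := by
  have h : N.served σ Y n 0 + N.forwarded σ n ≤ ∑ _k : Fin (q n 0), 1 := by
    unfold served forwarded
    rw [← Finset.sum_add_distrib]
    refine Finset.sum_le_sum fun k _ => ?_
    have h1 := hσ.one_conf ⟨(n, 0), k⟩
    revert h1
    cases σ.z ⟨(n, 0), k⟩ <;> cases Y ⟨(n, 0), k⟩ <;> cases σ.y ⟨(n, 0), k⟩ <;> simp
  simpa using h

/-- The law of the transmission outcomes: independent Bernoulli variables with the success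
probabilities of the packets. -/
noncomputable def outcomeLaw (N : CellNetwork V U) (q : QueueState U) : PMF (Packet q → Bool) :=
  (Measure.pi fun i : Packet q => bernoulliMeasure true false (N.p i.1.1 i.1.2)).toPMF

/-- The law of the vector of arrivals in one subframe, independent between users, the number of
arrivals for user `n` having law `ν n`. -/
noncomputable def arrivalLaw (ν : U → PMF ℕ) : PMF (U → ℕ) :=
  (Measure.pi fun n => (ν n).toMeasure).toPMF

/-- The number of arrivals of each user has a finite second moment. -/
def FiniteSecondMoment (ν : U → PMF ℕ) : Prop :=
  ∀ n, MemLp (fun k : ℕ => (k : ℝ)) 2 (ν n).toMeasure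

/-- The arrival-rate vector: the mean number of arrivals per subframe. -/
noncomputable def arrivalRate (ν : U → PMF ℕ) : U → ℝ :=
  fun n => ∫ k : ℕ, (k : ℝ) ∂(ν n).toMeasure

/-- The transition function of the queue-length Markov chain: schedule, transmission outcomes and
arrivals are drawn independently of each other and of the past, given the queue lengths. -/
noncomputable def transition (N : CellNetwork V U) (π : N.Policy) (ν : U → PMF ℕ)
    (q : QueueState U) : PMF (QueueState U) :=
  (π.law q).bind fun σ => (N.outcomeLaw q).bind fun Y => (arrivalLaw ν).map fun W => N.next σ Y W

/-! ### The region `Λ` -/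

/-- The mean number of packets of user `n` moved over the three types of links under `σ`: `0` is
single transmission, `1` is joint transmission, `2` is forwarding over the backhaul. -/
noncomputable def meanRate (N : CellNetwork V U) {q : QueueState U} (σ : Schedule N.S q) :
    U → Fin 3 → ℝ :=
  fun n => ![∑ k : Fin (q n 0), ((σ.z ⟨(n, 0), k⟩).toNat : ℝ) * (N.p n 0 : ℝ),
    ∑ k : Fin (q n 1), ((σ.z ⟨(n, 1), k⟩).toNat : ℝ) * (N.p n 1 : ℝ),
    ∑ k : Fin (q n 0), ((σ.y ⟨(n, 0), k⟩).toNat : ℝ)]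

/-- The rates that are achievable in saturation, i.e. when no queue can run out of packets during
the subframe. At most `S` packets of a queue are transmitted wirelessly and at most `K` are
forwarded, so that `S + K` packets in each queue suffice. -/
def saturatedRates (N : CellNetwork V U) : Set (U → Fin 3 → ℝ) :=
  {r | ∃ q : QueueState U, (∀ n β, N.S + N.K ≤ q n β) ∧
    ∃ σ : Schedule N.S q, N.Feasible σ ∧ r = N.meanRate σ}

/-- The `lam`-admissible traffic flows (links numbered as in `meanRate`). -/
def admissibleFlows (lam : U → ℝ) : Set (U → Fin 3 → ℝ) :=
  {f | (∀ n j, 0 ≤ f n j) ∧ ∀ n, lam n = f n 0 + f n 2 ∧ f n 2 = f n 1}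

/-- The set `Λ` of arrival-rate vectors. -/
def rateRegion (N : CellNetwork V U) : Set (U → ℝ) :=
  {lam | (∀ n, 0 ≤ lam n) ∧ ∃ f ∈ admissibleFlows lam, ∃ r ∈ convexHull ℝ N.saturatedRates,
    ∀ n j, 0 < f n j → f n j < r n j}

/-- The stability region of a policy: the arrival-rate vectors for which the queue-length process
is positive recurrent. -/
def stabilityRegion (N : CellNetwork V U) (π : N.Policy) : Set (U → ℝ) :=
  {lam | ∃ ν : U → PMF ℕ, FiniteSecondMoment ν ∧ arrivalRate ν = lam ∧
    IsPosRec (N.transition π ν)}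

/-- The capacity region: the union of the stability regions over all policies. -/
def capacityRegion (N : CellNetwork V U) : Set (U → ℝ) := ⋃ π : N.Policy, N.stabilityRegion π

end CellNetwork

set_option linter.unusedSectionVars false

/-! ### Expectations under a probability mass function -/

namespace PMF

variable {α β : Type*}

/-- The expectation of an extended nonnegative function. -/
noncomputable def expect (p : PMF α) (g : α → ENNReal) : ENNReal := ∑' a, p a * g a

theorem expect_add (p : PMF α) (f g : α → ENNReal) :
    p.expect (fun a => f a + g a) = p.expect f + p.expect g := by
  simp only [expect, mul_add, ENNReal.tsum_add]

theorem expect_const_mul (p : PMF α) (c : ENNReal) (f : α → ENNReal) :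
    p.expect (fun a => c * f a) = c * p.expect f := by
  simp only [expect, ← ENNReal.tsum_mul_left]
  exact tsum_congr fun a => by ring

theorem expect_const (p : PMF α) (c : ENNReal) : p.expect (fun _ => c) = c := by
  simp [expect, ENNReal.tsum_mul_right, p.tsum_coe]

theorem expect_sum {ι : Type*} (p : PMF α) (s : Finset ι) (f : ι → α → ENNReal) :
    p.expect (fun a => ∑ i ∈ s, f i a) = ∑ i ∈ s, p.expect (f i) := by
  classical
  induction s using Finset.induction_on with
  | empty => simp [expect]
  | insert i s hi ih => simp only [Finset.sum_insert hi, expect_add, ih]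

theorem expect_mono_support (p : PMF α) {f g : α → ENNReal}
    (h : ∀ a ∈ p.support, f a ≤ g a) : p.expect f ≤ p.expect g := by
  refine ENNReal.tsum_le_tsum fun a => ?_
  by_cases ha : p a = 0
  · simp [ha]
  · gcongr
    exact h a ((p.mem_support_iff a).2 ha)

theorem expect_mono (p : PMF α) {f g : α → ENNReal} (h : ∀ a, f a ≤ g a) :
    p.expect f ≤ p.expect g :=
  p.expect_mono_support fun a _ => h a

theorem expect_congr_support (p : PMF α) {f g : α → ENNReal}
    (h : ∀ a ∈ p.support, f a = g a) : p.expect f = p.expect g :=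
  le_antisymm (p.expect_mono_support fun a ha => (h a ha).le)
    (p.expect_mono_support fun a ha => (h a ha).ge)

theorem expect_bind (p : PMF α) (f : α → PMF β) (g : β → ENNReal) :
    (p.bind f).expect g = p.expect fun a => (f a).expect g := by
  simp only [expect, bind_apply, ← ENNReal.tsum_mul_right, ← ENNReal.tsum_mul_left]
  rw [ENNReal.tsum_comm]
  exact tsum_congr fun a => tsum_congr fun b => by ring

theorem expect_pure (a : α) (g : α → ENNReal) : (PMF.pure a).expect g = g a := by
  classical
  rw [expect, tsum_eq_single a]
  · simp
  · intro b hb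
    simp [hb]

theorem expect_map (p : PMF α) (f : α → β) (g : β → ENNReal) :
    (p.map f).expect g = p.expect fun a => g (f a) := by
  rw [← bind_pure_comp, expect_bind]
  simp [expect_pure]

theorem expect_iSup (p : PMF α) {f : ℕ → α → ENNReal} (hf : Monotone f) :
    p.expect (fun a => ⨆ n, f n a) = ⨆ n, p.expect (f n) := by
  let _ : MeasurableSpace α := ⊤
  have h := lintegral_iSup (μ := Measure.count) (f := fun n a => p a * f n a)
    (fun n => measurable_from_top) (fun m n hmn a => by dsimp only; gcongr; exact hf hmn a)
  simpa [lintegral_count, expect, ENNReal.mul_iSup] using h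

theorem expect_lt_one (p : PMF α) {g : α → ENNReal} (hg : ∀ a, g a ≤ 1) {a : α}
    (ha : p a ≠ 0) (h : g a < 1) : p.expect g < 1 := by
  rw [← p.tsum_coe]
  refine ENNReal.tsum_lt_tsum (i := a) ?_ (fun b => mul_le_of_le_one_right' (hg b)) ?_
  · refine ne_top_of_le_ne_top ENNReal.one_ne_top ?_
    rw [← p.tsum_coe]
    exact ENNReal.tsum_le_tsum fun b => mul_le_of_le_one_right' (hg b)
  · calc p a * g a < p a * 1 := (ENNReal.mul_lt_mul_iff_right ha (p.apply_ne_top a)).2 h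
      _ = p a := mul_one _

theorem ne_top_of_expect_ne_top (p : PMF α) {g : α → ENNReal} (h : p.expect g ≠ ⊤) {a : α}
    (ha : p a ≠ 0) : g a ≠ ⊤ := by
  rintro h'
  have := ENNReal.ne_top_of_tsum_ne_top h a
  rw [h', ENNReal.mul_top ha] at this
  exact this rfl

end PMF

/-! ### Hitting times of countable Markov chains -/

section Chain

variable {X : Type*} (P : X → PMF X)

theorem avoidProb_succ (T : Set X) (n : ℕ) (x : X) :
    avoidProb P T (n + 1) x = (P x).expect (Tᶜ.indicator (avoidProb P T n)) := rfl

theorem avoidProb_le_one (T : Set X) (n : ℕ) (x : X) : avoidProb P T n x ≤ 1 := by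
  induction n generalizing x with
  | zero => exact le_rfl
  | succ n ih =>
    rw [avoidProb_succ]
    refine ((P x).expect_mono fun y => ?_).trans ((P x).expect_const 1).le
    exact Set.indicator_le' (fun y _ => ih y) (fun _ _ => zero_le) y

theorem avoidProb_antitone (T : Set X) (x : X) : Antitone fun n => avoidProb P T n x := by
  refine antitone_nat_of_succ_le fun n => ?_
  induction n generalizing x with
  | zero => exact avoidProb_le_one P T 1 x
  | succ n ih =>
    rw [avoidProb_succ, avoidProb_succ P T n]
    exact (P x).expect_mono fun y => Set.indicator_le_indicator (ih y)

/-- The relation of being reachable in at least one step. -/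
abbrev ChainReach (x y : X) : Prop := Relation.TransGen (fun a b => P a b ≠ 0) x y

theorem exists_avoidProb_lt_one {T : Set X} {x y : X} (h : ChainReach P x y) (hy : y ∈ T) :
    ∃ n, avoidProb P T n x < 1 := by
  induction h using Relation.TransGen.head_induction_on with
  | @single x hx =>
    refine ⟨1, (P x).expect_lt_one (fun z => ?_) hx (by simp [hy])⟩
    exact Set.indicator_le' (fun y _ => avoidProb_le_one P T 0 y) (fun _ _ => zero_le) z
  | @head x z hx _ ih =>
    obtain ⟨n, hn⟩ := ih
    refine ⟨n + 1, (P x).expect_lt_one (fun z => ?_) hx ?_⟩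
    · exact Set.indicator_le' (fun y _ => avoidProb_le_one P T n y) (fun _ _ => zero_le) z
    · exact (Set.indicator_le_self _ _ _).trans_lt hn

theorem avoidProb_eq_one {T : Set X} {x : X} (h : ∀ y ∈ T, ¬ ChainReach P x y) (n : ℕ) :
    avoidProb P T n x = 1 := by
  induction n generalizing x with
  | zero => rfl
  | succ n ih =>
    rw [avoidProb_succ, ← (P x).expect_const 1]
    refine (P x).expect_congr_support fun y hy => ?_
    have hxy : P x y ≠ 0 := ((P x).mem_support_iff y).1 hy
    rw [Set.indicator_of_mem (show y ∈ Tᶜ from fun hyT => h y hyT (.single hxy))]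
    exact ih fun z hz hyz => h z hz (.head hxy hyz)

theorem sum_range_avoidProb (T : Set X) (N : ℕ) (x : X) :
    ∑ n ∈ Finset.range (N + 1), avoidProb P T n x =
      (P x).expect (fun y => ∑ n ∈ Finset.range N, Tᶜ.indicator (avoidProb P T n) y) + 1 := by
  rw [Finset.sum_range_succ', PMF.expect_sum]
  rfl

/-- A Lyapunov function bounds the expected hitting time. -/
theorem tsum_avoidProb_le {T : Set X} {W : X → ENNReal}
    (hW : ∀ x ∉ T, (P x).expect W + 1 ≤ W x) (x : X) :
    ∑' n, avoidProb P T n x ≤ (P x).expect W + 1 := by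
  have key : ∀ N x, ∑ n ∈ Finset.range (N + 1), avoidProb P T n x ≤ (P x).expect W + 1 := by
    intro N
    induction N with
    | zero =>
      intro x
      rw [sum_range_avoidProb]
      gcongr
      exact (P x).expect_mono fun y => by simp
    | succ N ih =>
      intro x
      rw [sum_range_avoidProb]
      gcongr
      refine (P x).expect_mono fun y => ?_
      by_cases hy : y ∈ T
      · simp [hy]
      · simpa [hy] using (ih y).trans (hW y hy)
  rw [ENNReal.tsum_eq_iSup_nat]
  refine iSup_le fun N => le_trans ?_ (key N x)
  exact Finset.sum_le_sum_of_subset (Finset.range_mono (Nat.le_succ N))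

variable {V : X → ENNReal} {F : Finset X} {C : ENNReal}

/-- If a Lyapunov function has negative drift outside of a finite set, each state of which leads to
`T`, then the expected hitting time of `T` is finite. -/
theorem tsum_avoidProb_ne_top (hC : C ≠ ⊤)
    (hV : ∀ x, (P x).expect V + 1 ≤ V x + (F : Set X).indicator (fun _ => C) x) {T : Set X}
    (hT : ∀ y ∈ F, V y ≠ ⊤ → ∃ n, avoidProb P T n y < 1) {x : X} (hx : V x ≠ ⊤) :
    ∑' n, avoidProb P T n x ≠ ⊤ := by
  classical
  have hn : ∃ N, ∀ y ∈ F, V y ≠ ⊤ → avoidProb P T N y < 1 := by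
    choose! n hn using hT
    exact ⟨F.sup n, fun y hy hy' =>
      (avoidProb_antitone P T y (Finset.le_sup hy)).trans_lt (hn y hy hy')⟩
  obtain ⟨N, hN⟩ := hn
  have hδ : ∃ δ : ENNReal, δ ≠ 0 ∧ δ ≠ ⊤ ∧ ∀ y ∈ F, V y ≠ ⊤ → avoidProb P T N y + δ ≤ 1 := by
    refine ⟨1 ⊓ (F.filter fun y => V y ≠ ⊤).inf fun y => 1 - avoidProb P T N y, ?_, ?_, ?_⟩
    · refine (lt_inf_iff.2 ⟨zero_lt_one, (Finset.lt_inf_iff ENNReal.zero_lt_top).2 ?_⟩).ne'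
      intro y hy
      rw [Finset.mem_filter] at hy
      exact tsub_pos_of_lt (hN y hy.1 hy.2)
    · exact ne_top_of_le_ne_top ENNReal.one_ne_top inf_le_left
    · intro y hy hy'
      have hmem : y ∈ F.filter fun y => V y ≠ ⊤ := Finset.mem_filter.2 ⟨hy, hy'⟩
      have h1 := Finset.inf_le (f := fun y => 1 - avoidProb P T N y) hmem
      calc _ ≤ avoidProb P T N y + (1 - avoidProb P T N y) := by
            gcongr
            exact inf_le_right.trans h1
        _ = 1 := add_tsub_cancel_of_le (avoidProb_le_one P T N y)
  obtain ⟨δ, hδ0, hδt, hδ⟩ := hδ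
  set h : X → ENNReal := fun y => ∑ n ∈ Finset.range N, Tᶜ.indicator (avoidProb P T n) y with hh
  have hle : ∀ y, h y ≤ N := fun y => by
    calc h y ≤ ∑ n ∈ Finset.range N, 1 := Finset.sum_le_sum fun n _ =>
          (Set.indicator_le_self _ _ _).trans (avoidProb_le_one P T n y)
      _ = N := by simp
  have hstep : ∀ y ∉ T, (P y).expect h + 1 = h y + avoidProb P T N y := fun y hy => by
    rw [← sum_range_avoidProb, Finset.sum_range_succ]
    simp [hh, hy]
  set D := C / δ with hD
  have hDt : D ≠ ⊤ := ENNReal.div_ne_top hC hδ0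
  have hW : ∀ y ∉ T, (P y).expect (fun z => V z + D * h z) + 1 ≤ V y + D * h y := by
    intro y hy
    rw [PMF.expect_add, PMF.expect_const_mul]
    have h1 := hV y
    by_cases hyF : y ∈ F
    · by_cases hyV : V y = ⊤
      · simp [hyV]
      have h2 : (P y).expect h + δ ≤ h y := by
        refine (ENNReal.add_le_add_iff_right
          (ne_top_of_le_ne_top ENNReal.one_ne_top (avoidProb_le_one P T N y))).1 ?_
        rw [← hstep y hy, add_assoc, add_comm δ]
        gcongr
        exact hδ y hyF hyV
      have h3 : C = D * δ := (ENNReal.div_mul_cancel hδ0 hδt).symm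
      simp only [Finset.mem_coe, hyF, Set.indicator_of_mem] at h1
      calc (P y).expect V + D * (P y).expect h + 1
          = ((P y).expect V + 1) + D * (P y).expect h := by ring
        _ ≤ (V y + D * δ) + D * (P y).expect h := by rw [← h3]; gcongr
        _ = V y + D * ((P y).expect h + δ) := by ring
        _ ≤ V y + D * h y := by gcongr
    · have h2 : (P y).expect h ≤ h y := by
        refine (ENNReal.add_le_add_iff_right ENNReal.one_ne_top).1 ?_
        rw [hstep y hy]
        gcongr
        exact avoidProb_le_one P T N y
      rw [Set.indicator_of_notMem (by simpa using hyF), add_zero] at h1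
      calc (P y).expect V + D * (P y).expect h + 1
          = ((P y).expect V + 1) + D * (P y).expect h := by ring
        _ ≤ V y + D * h y := by gcongr
  refine ne_top_of_le_ne_top ?_ (tsum_avoidProb_le P hW x)
  rw [PMF.expect_add, PMF.expect_const_mul]
  have h1 : (P x).expect V ≠ ⊤ := by
    refine ne_top_of_le_ne_top ?_ (le_self_add.trans (hV x))
    refine ENNReal.add_ne_top.2 ⟨hx, ?_⟩
    by_cases hxF : x ∈ (F : Set X)
    · simpa [hxF] using hC
    · simp [Set.indicator_of_notMem hxF]
  have h2 : (P x).expect h ≠ ⊤ :=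
    ne_top_of_le_ne_top (ENNReal.natCast_ne_top N)
      (((P x).expect_mono hle).trans ((P x).expect_const _).le)
  simp [h1, ENNReal.mul_ne_top hDt h2]

/-- The Foster–Lyapunov criterion, without irreducibility: a function with negative drift outside of
a finite set yields positive recurrence on the set where it is finite. -/
theorem posRecFrom_of_drift (hC : C ≠ ⊤)
    (hV : ∀ x, (P x).expect V + 1 ≤ V x + (F : Set X).indicator (fun _ => C) x) {x : X}
    (hx : V x ≠ ⊤) : PosRecFrom P x := by
  classical
  have hVt : ∀ {y}, V y ≠ ⊤ → (P y).expect V ≠ ⊤ := by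
    intro y hy
    refine ne_top_of_le_ne_top ?_ (le_self_add.trans (hV y))
    refine ENNReal.add_ne_top.2 ⟨hy, ?_⟩
    by_cases hyF : y ∈ (F : Set X)
    · simpa [hyF] using hC
    · simp [Set.indicator_of_notMem hyF]
  have hreach : ∀ {y z}, V y ≠ ⊤ → ChainReach P y z → V z ≠ ⊤ := by
    intro y z hy hyz
    induction hyz with
    | single h => exact (P y).ne_top_of_expect_ne_top (hVt hy) h
    | tail _ h ih => exact (P _).ne_top_of_expect_ne_top (hVt ih) h
  have hF : ∀ y, V y ≠ ⊤ → ∃ z ∈ F, ChainReach P y z := by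
    intro y hy
    by_contra! hno
    have h1 := tsum_avoidProb_le P (T := (F : Set X)) (W := V) (fun z hz => by
      simpa [Set.indicator_of_notMem hz] using hV z) y
    simp only [avoidProb_eq_one P (T := (F : Set X)) (x := y) (by simpa using hno)] at h1
    rw [ENNReal.tsum_const_eq_top_of_ne_zero one_ne_zero, top_le_iff] at h1
    simp [hVt hy] at h1
  let R : X → Finset X := fun y => F.filter fun z => ChainReach P y z
  have hmain : ∀ y ∈ F, V y ≠ ⊤ → ∃ w, IsPosRecState P w ∧ ChainReach P y w := by
    intro y _ hyV
    have hne : (R y).Nonempty := by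
      obtain ⟨z, hz, hyz⟩ := hF y hyV
      exact ⟨z, Finset.mem_filter.2 ⟨hz, hyz⟩⟩
    obtain ⟨z, hz, hmin⟩ := Finset.exists_min_image (R y) (fun z => (R z).card) hne
    have hyz := (Finset.mem_filter.1 hz).2
    obtain ⟨w, hwF, hzw⟩ := hF z (hreach hyV hyz)
    refine ⟨w, lt_top_iff_ne_top.2 ?_, hyz.trans hzw⟩
    have hwV := hreach hyV (hyz.trans hzw)
    let V' : X → ENNReal := fun v =>
      if Relation.ReflTransGen (fun a b => P a b ≠ 0) w v then V v else ⊤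
    refine tsum_avoidProb_ne_top P (V := V') (F := F) hC ?_ ?_ (x := w)
      (by simpa [V', Relation.ReflTransGen.refl] using hwV)
    · intro v
      by_cases hv : Relation.ReflTransGen (fun a b => P a b ≠ 0) w v
      · have : (P v).expect V' = (P v).expect V := by
          refine (P v).expect_congr_support fun u hu => ?_
          exact if_pos (hv.tail (((P v).mem_support_iff u).1 hu))
        rw [this]
        simpa [V', hv] using hV v
      · simp [V', hv]
    · intro v hv hv'
      have hwv : Relation.ReflTransGen (fun a b => P a b ≠ 0) w v := by
        by_contra hcon
        simp [V', hcon] at hv'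
      have hzv : ChainReach P z v := Relation.TransGen.trans_left hzw hwv
      have hsub : R v ⊆ R z := fun u hu => by
        rw [Finset.mem_filter] at hu ⊢
        exact ⟨hu.1, hzv.trans hu.2⟩
      have heq : R v = R z :=
        Finset.eq_of_subset_of_card_le hsub (hmin v (Finset.mem_filter.2 ⟨hv, hyz.trans hzv⟩))
      have hw : w ∈ R v := heq ▸ Finset.mem_filter.2 ⟨hwF, hzw⟩
      exact exists_avoidProb_lt_one P (Finset.mem_filter.1 hw).2 rfl
  have hsum := tsum_avoidProb_ne_top P hC hV (T := {y | IsPosRecState P y}) (fun y hy hy' => by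
    obtain ⟨w, hw, hyw⟩ := hmain y hy hy'
    exact exists_avoidProb_lt_one P hyw hw) hx
  have hlim := ENNReal.tendsto_atTop_zero_of_tsum_ne_top hsum
  exact tendsto_nhds_unique (tendsto_atTop_iInf (avoidProb_antitone P _ x)) hlim

theorem PosRecFrom.exists_isPosRecState {x : X} (h : PosRecFrom P x) :
    ∃ y, IsPosRecState P y := by
  by_contra! hno
  have : {y | IsPosRecState P y} = ∅ := Set.eq_empty_of_forall_notMem hno
  simp [PosRecFrom, this, avoidProb_eq_one P (T := (∅ : Set X)) (x := x) (by simp)] at h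

/-! ### Stationary distributions -/

open Classical in
/-- The distribution of the chain started in `x` at time `n` on the event that it has not returned
to `x` by then. -/
noncomputable def tabooMass (x : X) : ℕ → X → ENNReal
  | 0, z => if z = x then 1 else 0
  | n + 1, z => if z = x then 0 else ∑' y, tabooMass x n y * P y z

theorem tsum_tabooMass_mul (x : X) (n k : ℕ) :
    ∑' z, tabooMass P x n z * avoidProb P {x} k z = avoidProb P {x} (n + k) x := by
  classical
  induction n generalizing k with
  | zero =>
    rw [tsum_eq_single x]
    · simp [tabooMass]
    · intro z hz
      simp [tabooMass, hz]
  | succ n ih =>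
    have : n + 1 + k = n + (k + 1) := by ring
    rw [this, ← ih (k + 1)]
    have h1 : ∀ z, tabooMass P x (n + 1) z * avoidProb P {x} k z =
        ∑' y, tabooMass P x n y * (P y z * ({x}ᶜ : Set X).indicator (avoidProb P {x} k) z) := by
      intro z
      by_cases hz : z = x
      · simp [tabooMass, hz]
      · simp only [tabooMass, hz, if_false]
        rw [Set.indicator_of_mem (by simpa using hz), ← ENNReal.tsum_mul_right]
        exact tsum_congr fun y => by ring
    simp only [h1]
    rw [ENNReal.tsum_comm]
    exact tsum_congr fun y => by rw [ENNReal.tsum_mul_left]; rfl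

/-- A chain with a positive recurrent state has a stationary distribution. -/
theorem IsPosRecState.exists_stationary {x : X} (hx : IsPosRecState P x) :
    ∃ m : PMF X, m.bind P = m := by
  classical
  let m : X → ENNReal := fun z => ∑' n, tabooMass P x n z
  have hmass : ∑' z, m z = ∑' n, avoidProb P {x} n x := by
    rw [ENNReal.tsum_comm]
    refine tsum_congr fun n => ?_
    have := tsum_tabooMass_mul P x n 0
    simpa [avoidProb] using this
  have hfin : ∑' z, m z ≠ ⊤ := by
    rw [hmass]
    exact hx.ne
  have hne : ∑' z, m z ≠ 0 := by
    rw [hmass]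
    intro h
    have := ENNReal.tsum_eq_zero.1 h 0
    simp [avoidProb] at this
  have hP : ∀ z, z ≠ x → ∑' y, m y * P y z = m z := by
    intro z hz
    have h1 : m z = tabooMass P x 0 z + ∑' n, tabooMass P x (n + 1) z :=
      tsum_eq_zero_add' ENNReal.summable
    simp only [tabooMass, hz, if_false, zero_add] at h1
    rw [h1, ENNReal.tsum_comm]
    exact tsum_congr fun y => by rw [ENNReal.tsum_mul_right]
  have htot : ∑' z, ∑' y, m y * P y z = ∑' z, m z := by
    rw [ENNReal.tsum_comm]
    exact tsum_congr fun y => by rw [ENNReal.tsum_mul_left, (P y).tsum_coe, mul_one]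
  have hPx : ∑' y, m y * P y x = m x := by
    rw [ENNReal.tsum_eq_add_tsum_ite (f := fun z => ∑' y, m y * P y z) x,
      ENNReal.tsum_eq_add_tsum_ite (f := m) x] at htot
    have h2 : ∑' z, (if z = x then 0 else ∑' y, m y * P y z) = ∑' z, if z = x then 0 else m z :=
      tsum_congr fun z => by
        split_ifs with hz
        · rfl
        · exact hP z hz
    rw [h2] at htot
    refine (ENNReal.add_left_inj ?_).1 htot
    refine ne_top_of_le_ne_top hfin (ENNReal.tsum_le_tsum fun z => ?_)
    split_ifs <;> simp
  refine ⟨PMF.normalize m hne hfin, PMF.ext fun z => ?_⟩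
  rw [PMF.bind_apply]
  simp only [PMF.normalize_apply]
  have h3 : ∑' y, m y * P y z = m z := by
    by_cases hz : z = x
    · rw [hz, hPx]
    · exact hP z hz
  calc ∑' y, m y * (∑' z, m z)⁻¹ * P y z = ∑' y, (m y * P y z) * (∑' z, m z)⁻¹ :=
        tsum_congr fun y => by ring
    _ = m z * (∑' z, m z)⁻¹ := by rw [ENNReal.tsum_mul_right, h3]

end Chain

/-! ### Expectations of outcomes and arrivals -/

theorem Measure.expect_toPMF {α : Type*} [Countable α] [MeasurableSpace α]
    [MeasurableSingletonClass α] (μ : Measure α) [IsProbabilityMeasure μ] (g : α → ENNReal) :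
    μ.toPMF.expect g = ∫⁻ a, g a ∂μ := by
  rw [lintegral_countable']
  exact tsum_congr fun a => by rw [Measure.toPMF_apply, mul_comm]

theorem PMF.expect_eq_lintegral {α : Type*} [Countable α] [MeasurableSpace α]
    [MeasurableSingletonClass α] (p : PMF α) (g : α → ENNReal) :
    p.expect g = ∫⁻ a, g a ∂p.toMeasure := by
  rw [lintegral_countable']
  exact tsum_congr fun a => by
    rw [PMF.toMeasure_apply_singleton _ _ (measurableSet_singleton a), mul_comm]

/-- Partial injections between finite types preserve sums of indicators. -/
theorem sum_elim_eq {α β : Type*} [Fintype α] [Fintype β] {g : α → Option β}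
    (hg : ∀ a a' b, g a = some b → g a' = some b → a = a') (f : β → Bool)
    (hf : ∀ b, f b = true → ∃ a, g a = some b) :
    ∑ a, ((g a).elim false f).toNat = ∑ b, (f b).toNat := by
  classical
  have h1 : ∀ a, ((g a).elim false f).toNat = ∑ b, if g a = some b then (f b).toNat else 0 := by
    intro a
    cases g a <;> simp
  simp only [h1]
  rw [Finset.sum_comm]
  refine Finset.sum_congr rfl fun b _ => ?_
  by_cases hb : f b = true
  · obtain ⟨a, ha⟩ := hf b hb
    rw [Finset.sum_eq_single a]
    · simp [ha]
    · intro a' _ ha'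
      exact if_neg fun h => ha' (hg _ _ _ h ha)
    · simp
  · simp [hb]

theorem sum_elim_le {α β : Type*} [Fintype α] [Fintype β] {g : α → Option β}
    (hg : ∀ a a' b, g a = some b → g a' = some b → a = a') (f : β → Bool) :
    ∑ a, ((g a).elim false f).toNat ≤ ∑ b, (f b).toNat := by
  classical
  have h1 : ∀ a, (g a).elim false f = (g a).elim false fun b => f b && decide (∃ a, g a = some b) := by
    intro a
    rcases h : g a with - | b
    · rfl
    · have : ∃ a, g a = some b := ⟨a, h⟩
      simp [this]
  simp only [h1]
  rw [sum_elim_eq hg _ fun b hb => by simp only [Bool.and_eq_true, decide_eq_true_eq] at hb; exact hb.2]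
  refine Finset.sum_le_sum fun b _ => ?_
  cases f b <;> simp [Bool.toNat_le]

theorem exists_partial_injection {α β : Type*} [Fintype α] (A : Finset β)
    (h : A.card ≤ Fintype.card α) :
    ∃ g : α → Option β, (∀ a a' b, g a = some b → g a' = some b → a = a') ∧
      ∀ b ∈ A, ∃ a, g a = some b := by
  classical
  obtain ⟨e⟩ : Nonempty (A ↪ α) := by
    rw [Function.Embedding.nonempty_iff_card_le]
    simpa using h
  have he := e.injective.isPartialInv
  refine ⟨fun a => (Function.partialInv e a).map Subtype.val, fun a a' b h1 h2 => ?_, fun b hb => ?_⟩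
  · rw [Option.map_eq_some_iff] at h1 h2
    obtain ⟨x, hx, rfl⟩ := h1
    obtain ⟨y, hy, hxy⟩ := h2
    rw [← (he x a).1 hx, ← (he y a').1 hy, Subtype.ext hxy]
  · exact ⟨e ⟨b, hb⟩, by simp [(he ⟨b, hb⟩ _).2 rfl]⟩

instance {U : Type*} [Fintype U] {S : ℕ} {q : QueueState U} : Finite (Schedule S q) :=
  Finite.of_injective (fun σ : Schedule S q => (σ.z, σ.y, σ.x)) fun σ τ h => by
    cases σ
    cases τ
    simpa using h

namespace CellNetwork

variable {V U : Type*} [DecidableEq V] [Fintype U] [DecidableEq U]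

theorem expect_outcomeLaw (N : CellNetwork V U) (q : QueueState U) (i : Packet q) :
    (N.outcomeLaw q).expect (fun Y => ((Y i).toNat : ENNReal)) =
      ENNReal.ofReal (N.p i.1.1 i.1.2) := by
  rw [outcomeLaw, Measure.expect_toPMF]
  have hmp := measurePreserving_eval
    (fun i : Packet q => bernoulliMeasure true false (N.p i.1.1 i.1.2)) i
  have := hmp.lintegral_comp (f := fun b : Bool => (b.toNat : ENNReal)) (by fun_prop)
  refine this.trans ?_
  rw [lintegral_countable']
  simp [bernoulliMeasure_def, ENNReal.ofReal, Real.toNNReal_of_nonneg (N.p i.1.1 i.1.2).2.1]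
  rfl

theorem expect_arrivalLaw (ν : U → PMF ℕ) (n : U) (g : ℕ → ENNReal) :
    (arrivalLaw ν).expect (fun W => g (W n)) = (ν n).expect g := by
  rw [arrivalLaw, Measure.expect_toPMF, PMF.expect_eq_lintegral]
  exact (measurePreserving_eval (fun n => (ν n).toMeasure) n).lintegral_comp
    (f := g) measurable_from_top

theorem expect_sq_ne_top {ν : U → PMF ℕ} (hν : FiniteSecondMoment ν) (n : U) :
    (ν n).expect (fun k => (k : ENNReal) ^ 2) ≠ ⊤ := by
  rw [PMF.expect_eq_lintegral]
  have h := ((hν n).integrable_sq).lintegral_lt_top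
  refine (lt_of_eq_of_lt (lintegral_congr fun k => ?_) h).ne
  rw [ENNReal.ofReal_pow (by positivity), ENNReal.ofReal_natCast]

theorem expect_arrivalRate {ν : U → PMF ℕ} (hν : FiniteSecondMoment ν) (n : U) :
    (ν n).expect (fun k => (k : ENNReal)) = ENNReal.ofReal (arrivalRate ν n) := by
  rw [PMF.expect_eq_lintegral, arrivalRate, ofReal_integral_eq_lintegral_ofReal]
  · simp
  · exact (hν n).integrable (by norm_num)
  · exact ae_of_all _ fun k => by positivity

theorem arrivalRate_nonneg (ν : U → PMF ℕ) (n : U) : 0 ≤ arrivalRate ν n :=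
  integral_nonneg fun k => by positivity

/-! ### Feasible schedules -/

theorem sum_queue_le {q : QueueState U} (f : Packet q → ℕ) (c : U × Fin 2)
    (p : Packet q → Prop) [DecidablePred p] (hp : ∀ k, p ⟨c, k⟩) :
    ∑ k, f ⟨c, k⟩ ≤ ∑ i with p i, f i := by
  refine (Finset.sum_map Finset.univ (Function.Embedding.sigmaMk c) f).symm.trans_le ?_
  refine Finset.sum_le_sum_of_subset fun i hi => ?_
  rw [Finset.mem_map] at hi
  obtain ⟨k, -, rfl⟩ := hi
  simpa using hp k

theorem bs_mem_stations (N : CellNetwork V U) {q : QueueState U} (i : Packet q) :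
    N.bs i.1.1 ∈ N.stations i := by
  unfold stations
  split_ifs <;> simp

variable {N : CellNetwork V U} {q : QueueState U} {σ : Schedule N.S q}

theorem Feasible.sum_z_le (hσ : N.Feasible σ) (n : U) (β : Fin 2) :
    ∑ k : Fin (q n β), (σ.z ⟨(n, β), k⟩).toNat ≤ N.S :=
  (sum_queue_le (fun i => (σ.z i).toNat) (n, β) (fun i => N.bs n ∈ N.stations i)
    fun k => N.bs_mem_stations ⟨(n, β), k⟩).trans (hσ.subframe_cap (N.bs n))

theorem Feasible.sum_y_le (hσ : N.Feasible σ) (n : U) (β : Fin 2) :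
    ∑ k : Fin (q n β), (σ.y ⟨(n, β), k⟩).toNat ≤ N.K := by
  by_cases hβ : β = 0
  · subst hβ
    rcases h : N.sec n with - | b
    · simp [fun k => hσ.no_secondary_forward ⟨(n, 0), k⟩ h]
    · exact (sum_queue_le (fun i => (σ.y i).toNat) (n, 0)
        (fun i => i.1.2 = 0 ∧ N.link i.1.1 = some s(N.bs n, b)) fun k => by simp [link, h]).trans
        (hσ.backhaul_cap s(N.bs n, b) (N.adj n b h))
  · have h1 : β = 1 := by omega
    subst h1
    simp [fun k => hσ.no_second_forward ⟨(n, 1), k⟩ rfl]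

end CellNetwork

/-- Transport of a schedule along partial maps between the queues. -/
def Schedule.pullback {U : Type*} {S : ℕ} {q q' : QueueState U} (σ : Schedule S q')
    (g : ∀ c : U × Fin 2, Fin (q c.1 c.2) → Option (Fin (q' c.1 c.2))) : Schedule S q where
  z i := (g i.1 i.2).elim false fun k => σ.z ⟨i.1, k⟩
  y i := (g i.1 i.2).elim false fun k => σ.y ⟨i.1, k⟩
  x i s := (g i.1 i.2).elim false fun k => σ.x ⟨i.1, k⟩ s

namespace CellNetwork

variable {V U : Type*} [DecidableEq V] [Fintype U] [DecidableEq U]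
variable {N : CellNetwork V U} {q q' : QueueState U}

theorem sum_pullback_le
    {g : ∀ c : U × Fin 2, Fin (q c.1 c.2) → Option (Fin (q' c.1 c.2))}
    (hg : ∀ c a a' b, g c a = some b → g c a' = some b → a = a') (f : Packet q' → Bool)
    (p : U × Fin 2 → Prop) [DecidablePred p] :
    ∑ i : Packet q with p i.1, ((g i.1 i.2).elim false fun k => f ⟨i.1, k⟩).toNat ≤
      ∑ i : Packet q' with p i.1, (f i).toNat := by
  rw [Finset.sum_filter, Finset.sum_filter, Fintype.sum_sigma, Fintype.sum_sigma]
  refine Finset.sum_le_sum fun c _ => ?_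
  by_cases hc : p c
  · simp only [hc, if_true]
    exact sum_elim_le (hg c) fun k => f ⟨c, k⟩
  · simp [hc]

theorem Feasible.pullback {σ : Schedule N.S q'} (hσ : N.Feasible σ)
    {g : ∀ c : U × Fin 2, Fin (q c.1 c.2) → Option (Fin (q' c.1 c.2))}
    (hg : ∀ c a a' b, g c a = some b → g c a' = some b → a = a') :
    N.Feasible (σ.pullback g) where
  one_conf := by
    rintro ⟨c, k⟩
    simp only [Schedule.pullback]
    cases g c k with
    | none => simp
    | some b => exact hσ.one_conf ⟨c, b⟩
  subframe_cap a := (sum_pullback_le hg σ.z fun c => a ∈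
    if c.2 = 0 then {N.bs c.1} else {N.bs c.1} ∪ (N.sec c.1).toFinset).trans (hσ.subframe_cap a)
  backhaul_cap l hl := (sum_pullback_le hg σ.y fun c => c.2 = 0 ∧ N.link c.1 = some l).trans
    (hσ.backhaul_cap l hl)
  blocks := by
    rintro ⟨c, k⟩
    simp only [Schedule.pullback]
    cases g c k with
    | none => simp
    | some b => exact hσ.blocks ⟨c, b⟩
  no_second_forward := by
    rintro ⟨c, k⟩ h
    simp only [Schedule.pullback]
    cases g c k with
    | none => rfl
    | some b => exact hσ.no_second_forward ⟨c, b⟩ h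
  used_once a s := (sum_pullback_le hg (fun i => σ.x i s) fun c => a ∈
    if c.2 = 0 then {N.bs c.1} else {N.bs c.1} ∪ (N.sec c.1).toFinset).trans (hσ.used_once a s)
  no_secondary_forward := by
    rintro ⟨c, k⟩ h
    simp only [Schedule.pullback]
    cases g c k with
    | none => rfl
    | some b => exact hσ.no_secondary_forward ⟨c, b⟩ h
  no_secondary_joint := by
    rintro ⟨c, k⟩ h h'
    simp only [Schedule.pullback]
    cases g c k with
    | none => rfl
    | some b => exact hσ.no_secondary_joint ⟨c, b⟩ h h'

/-- A feasible schedule can be carried over to any other queue state, keeping the number of packets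
of each queue that are transmitted and forwarded, as far as the queue is long enough. -/
theorem Feasible.exists_transfer {σ : Schedule N.S q'} (hσ : N.Feasible σ) (q : QueueState U) :
    ∃ τ : Schedule N.S q, N.Feasible τ ∧ ∀ n β, N.S + N.K ≤ q n β →
      ∑ k : Fin (q n β), (τ.z ⟨(n, β), k⟩).toNat = ∑ k : Fin (q' n β), (σ.z ⟨(n, β), k⟩).toNat ∧
      ∑ k : Fin (q n β), (τ.y ⟨(n, β), k⟩).toNat =
        ∑ k : Fin (q' n β), (σ.y ⟨(n, β), k⟩).toNat := by
  have hex : ∀ c : U × Fin 2, ∃ g : Fin (q c.1 c.2) → Option (Fin (q' c.1 c.2)),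
      (∀ a a' b, g a = some b → g a' = some b → a = a') ∧ (N.S + N.K ≤ q c.1 c.2 →
        ∀ b, (σ.z ⟨c, b⟩ = true ∨ σ.y ⟨c, b⟩ = true) → ∃ a, g a = some b) := by
    intro c
    by_cases hc : N.S + N.K ≤ q c.1 c.2
    · let A : Finset (Fin (q' c.1 c.2)) :=
        Finset.univ.filter fun b => σ.z ⟨c, b⟩ = true ∨ σ.y ⟨c, b⟩ = true
      have hA : A.card ≤ N.S + N.K := by
        calc A.card = ∑ b, if σ.z ⟨c, b⟩ = true ∨ σ.y ⟨c, b⟩ = true then 1 else 0 := by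
              rw [Finset.card_filter]
          _ ≤ ∑ b, ((σ.z ⟨c, b⟩).toNat + (σ.y ⟨c, b⟩).toNat) :=
              Finset.sum_le_sum fun b _ => by
                cases σ.z ⟨c, b⟩ <;> cases σ.y ⟨c, b⟩ <;> simp
          _ ≤ N.S + N.K := by
              rw [Finset.sum_add_distrib]
              exact add_le_add (hσ.sum_z_le c.1 c.2) (hσ.sum_y_le c.1 c.2)
      obtain ⟨g, hg, hgA⟩ := exists_partial_injection (α := Fin (q c.1 c.2)) A
        (by simpa using hA.trans hc)
      exact ⟨g, hg, fun _ b hb => hgA b (Finset.mem_filter.2 ⟨Finset.mem_univ _, hb⟩)⟩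
    · exact ⟨fun _ => none, by simp, fun h => absurd h hc⟩
  choose g hg hgA using hex
  refine ⟨σ.pullback g, hσ.pullback hg, fun n β hn => ⟨?_, ?_⟩⟩
  · exact sum_elim_eq (hg (n, β)) (fun k => σ.z ⟨(n, β), k⟩) fun b hb =>
      hgA (n, β) hn b (Or.inl hb)
  · exact sum_elim_eq (hg (n, β)) (fun k => σ.y ⟨(n, β), k⟩) fun b hb =>
      hgA (n, β) hn b (Or.inr hb)

/-! ### Mean rates -/

theorem meanRate_zero (N : CellNetwork V U) {q : QueueState U} (σ : Schedule N.S q) (n : U) :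
    N.meanRate σ n 0 = ((∑ k : Fin (q n 0), (σ.z ⟨(n, 0), k⟩).toNat : ℕ) : ℝ) * N.p n 0 := by
  simp [meanRate, Finset.sum_mul]

theorem meanRate_one (N : CellNetwork V U) {q : QueueState U} (σ : Schedule N.S q) (n : U) :
    N.meanRate σ n 1 = ((∑ k : Fin (q n 1), (σ.z ⟨(n, 1), k⟩).toNat : ℕ) : ℝ) * N.p n 1 := by
  simp [meanRate, Finset.sum_mul]

theorem meanRate_two (N : CellNetwork V U) {q : QueueState U} (σ : Schedule N.S q) (n : U) :
    N.meanRate σ n 2 = (N.forwarded σ n : ℝ) := by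
  simp [meanRate, forwarded]

theorem meanRate_nonneg (N : CellNetwork V U) {q : QueueState U} (σ : Schedule N.S q) (n : U)
    (j : Fin 3) : 0 ≤ N.meanRate σ n j := by
  have h0 := (N.p n 0).2.1
  have h1 := (N.p n 1).2.1
  match j with
  | 0 => rw [meanRate_zero]; positivity
  | 1 => rw [meanRate_one]; positivity
  | 2 => rw [meanRate_two]; positivity

theorem Feasible.forwarded_le {σ : Schedule N.S q} (hσ : N.Feasible σ) (n : U) :
    N.forwarded σ n ≤ N.K :=
  hσ.sum_y_le n 0

theorem served_le_sum_z (N : CellNetwork V U) {q : QueueState U} (σ : Schedule N.S q)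
    (Y : Packet q → Bool) (n : U) (β : Fin 2) :
    N.served σ Y n β ≤ ∑ k : Fin (q n β), (σ.z ⟨(n, β), k⟩).toNat :=
  Finset.sum_le_sum fun k _ => by
    cases σ.z ⟨(n, β), k⟩ <;> cases Y ⟨(n, β), k⟩ <;> simp

theorem Feasible.served_le_S {σ : Schedule N.S q} (hσ : N.Feasible σ) (Y : Packet q → Bool) (n : U)
    (β : Fin 2) : N.served σ Y n β ≤ N.S :=
  (N.served_le_sum_z σ Y n β).trans (hσ.sum_z_le n β)

theorem Feasible.meanRate_le {σ : Schedule N.S q} (hσ : N.Feasible σ) (n : U) (j : Fin 3) :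
    N.meanRate σ n j ≤ N.S + N.K := by
  have hz : ∀ β, ((∑ k : Fin (q n β), (σ.z ⟨(n, β), k⟩).toNat : ℕ) : ℝ) * N.p n β ≤
      N.S + N.K := fun β => by
    have h2 : ((∑ k : Fin (q n β), (σ.z ⟨(n, β), k⟩).toNat : ℕ) : ℝ) ≤ N.S :=
      Nat.cast_le.2 (hσ.sum_z_le n β)
    calc _ ≤ (N.S : ℝ) * 1 :=
          mul_le_mul h2 (N.p n β).2.2 (N.p n β).2.1 (by positivity)
      _ ≤ N.S + N.K := by simp
  match j with
  | 0 => rw [meanRate_zero]; exact hz 0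
  | 1 => rw [meanRate_one]; exact hz 1
  | 2 =>
    rw [meanRate_two]
    have h2 : (N.forwarded σ n : ℝ) ≤ N.K := Nat.cast_le.2 (hσ.forwarded_le n)
    have h3 : (0 : ℝ) ≤ N.S := by positivity
    linarith

/-- The schedule of `Feasible.exists_transfer` has the same mean rates in long queues. -/
theorem Feasible.exists_transfer_meanRate {σ : Schedule N.S q'} (hσ : N.Feasible σ)
    (q : QueueState U) :
    ∃ τ : Schedule N.S q, N.Feasible τ ∧ ∀ n,
      (N.S + N.K ≤ q n 0 → N.meanRate τ n 0 = N.meanRate σ n 0 ∧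
        N.meanRate τ n 2 = N.meanRate σ n 2) ∧
      (N.S + N.K ≤ q n 1 → N.meanRate τ n 1 = N.meanRate σ n 1) := by
  obtain ⟨τ, hτ, h⟩ := hσ.exists_transfer q
  refine ⟨τ, hτ, fun n => ⟨fun hn => ⟨?_, ?_⟩, fun hn => ?_⟩⟩
  · rw [meanRate_zero, meanRate_zero, (h n 0 hn).1]
  · rw [meanRate_two, meanRate_two, forwarded, forwarded, (h n 0 hn).2]
  · rw [meanRate_one, meanRate_one, (h n 1 hn).1]

theorem Feasible.meanRate_mem {σ : Schedule N.S q} (hσ : N.Feasible σ) :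
    N.meanRate σ ∈ N.saturatedRates := by
  obtain ⟨τ, hτ, h⟩ := hσ.exists_transfer_meanRate fun _ _ => N.S + N.K
  refine ⟨_, fun _ _ => le_rfl, τ, hτ, ?_⟩
  funext n j
  match j with
  | 0 => exact ((h n).1 le_rfl).1.symm
  | 1 => exact ((h n).2 le_rfl).symm
  | 2 => exact ((h n).1 le_rfl).2.symm

theorem saturatedRates_finite (N : CellNetwork V U) : N.saturatedRates.Finite := by
  let φ : (U → Fin 3 → Fin (N.S + N.K + 1)) → U → Fin 3 → ℝ := fun c n j =>
    (c n j : ℕ) * (![(N.p n 0 : ℝ), N.p n 1, 1] j)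
  refine (Set.finite_range φ).subset ?_
  rintro r ⟨q, -, σ, hσ, rfl⟩
  have hS : ∀ n β, ∑ k : Fin (q n β), (σ.z ⟨(n, β), k⟩).toNat < N.S + N.K + 1 := fun n β => by
    have := hσ.sum_z_le n β
    omega
  refine ⟨fun n => ![⟨_, hS n 0⟩, ⟨_, hS n 1⟩, ⟨N.forwarded σ n, ?_⟩], ?_⟩
  · have := hσ.forwarded_le n
    omega
  · funext n j
    match j with
    | 0 => rw [meanRate_zero]; simp [φ]
    | 1 => rw [meanRate_one]; simp [φ]
    | 2 => rw [meanRate_two]; simp [φ]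

theorem expect_served (N : CellNetwork V U) {q : QueueState U} (σ : Schedule N.S q) (n : U)
    (β : Fin 2) :
    (N.outcomeLaw q).expect (fun Y => (N.served σ Y n β : ENNReal)) =
      ENNReal.ofReal (((∑ k : Fin (q n β), (σ.z ⟨(n, β), k⟩).toNat : ℕ) : ℝ) * N.p n β) := by
  simp only [served, Nat.cast_sum, Nat.cast_mul]
  rw [PMF.expect_sum, Finset.sum_mul, ENNReal.ofReal_sum_of_nonneg
    fun k _ => mul_nonneg (by positivity) (N.p n β).2.1]
  refine Finset.sum_congr rfl fun k _ => ?_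
  rw [PMF.expect_const_mul, expect_outcomeLaw, ENNReal.ofReal_mul (by positivity),
    ENNReal.ofReal_natCast]

end CellNetwork

namespace CellNetwork

variable {V U : Type*} [DecidableEq V] [Fintype U] [DecidableEq U]
variable {N : CellNetwork V U} {q q' : QueueState U}

/-! ### The convex hull of the saturated rates -/

theorem convexHull_rate_le {n : U} {j : Fin 3} {c : ℝ} (h : ∀ r ∈ N.saturatedRates, r n j ≤ c)
    {r : U → Fin 3 → ℝ} (hr : r ∈ convexHull ℝ N.saturatedRates) : r n j ≤ c := by
  have hlin : IsLinearMap ℝ fun r : U → Fin 3 → ℝ => r n j := ⟨fun _ _ => rfl, fun _ _ => rfl⟩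
  exact convexHull_min (t := {r : U → Fin 3 → ℝ | r n j ≤ c}) (fun r hr => h r hr)
    (convex_halfSpace_le hlin c) hr

theorem convexHull_rate_nonneg {r : U → Fin 3 → ℝ} (hr : r ∈ convexHull ℝ N.saturatedRates)
    (n : U) (j : Fin 3) : 0 ≤ r n j := by
  have hlin : IsLinearMap ℝ fun r : U → Fin 3 → ℝ => r n j := ⟨fun _ _ => rfl, fun _ _ => rfl⟩
  refine convexHull_min (t := {r : U → Fin 3 → ℝ | 0 ≤ r n j}) ?_ (convex_halfSpace_ge hlin 0) hr
  rintro r ⟨q, -, σ, -, rfl⟩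
  exact N.meanRate_nonneg σ n j

theorem convexHull_rate_zero_le {r : U → Fin 3 → ℝ} (hr : r ∈ convexHull ℝ N.saturatedRates)
    (n : U) : r n 0 ≤ N.S * N.p n 0 := by
  refine convexHull_rate_le ?_ hr
  rintro r ⟨q, -, σ, hσ, rfl⟩
  rw [meanRate_zero]
  exact mul_le_mul_of_nonneg_right (Nat.cast_le.2 (hσ.sum_z_le n 0)) (N.p n 0).2.1

theorem convexHull_rate_one_le_zero {r : U → Fin 3 → ℝ}
    (hr : r ∈ convexHull ℝ N.saturatedRates) {n : U} (hn : N.sec n = none) : r n 1 ≤ 0 := by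
  refine convexHull_rate_le ?_ hr
  rintro r ⟨q, -, σ, hσ, rfl⟩
  rw [meanRate_one]
  simp [fun k => hσ.no_secondary_joint ⟨(n, 1), k⟩ hn rfl]

theorem feasible_empty : N.Feasible (⟨fun _ => false, fun _ => false, fun _ _ => false⟩ :
    Schedule N.S q) := by
  constructor <;> simp

/-- The joint transmission of a single packet is feasible. -/
theorem exists_joint_rate {n : U} (hS : 0 < N.S) (hn : N.sec n ≠ none) :
    ∃ r ∈ N.saturatedRates, r n 1 = N.p n 1 := by
  let q : QueueState U := fun _ _ => N.S + N.K
  let i₀ : Packet q := ⟨(n, 1), ⟨0, by dsimp only [q]; omega⟩⟩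
  let σ : Schedule N.S q := ⟨fun i => decide (i = i₀), fun _ => false,
    fun i s => decide (i = i₀) && decide (s = ⟨0, hS⟩)⟩
  have hsum : ∀ p : Packet q → Prop, ∀ [DecidablePred p],
      ∑ i with p i, (decide (i = i₀)).toNat ≤ 1 := by
    intro p _
    calc _ ≤ ∑ i, (decide (i = i₀)).toNat :=
          Finset.sum_le_sum_of_subset (Finset.filter_subset _ _)
      _ = ∑ i, if i = i₀ then 1 else 0 := Finset.sum_congr rfl fun i _ => by
          by_cases h : i = i₀ <;> simp [h]
      _ ≤ 1 := by simp
  have hσ : N.Feasible σ := by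
    constructor
    · intro i
      by_cases h : i = i₀ <;> simp [σ, h]
    · exact fun a => (hsum _).trans hS
    · simp [σ]
    · intro i
      by_cases h : i = i₀
      · simp only [σ, h, decide_true, Bool.true_and]
        rw [Finset.sum_eq_single ⟨0, hS⟩] <;> simp +contextual
      · simp [σ, h]
    · simp [σ]
    · intro b s
      refine le_trans (Finset.sum_le_sum fun i _ => ?_) (hsum _)
      dsimp only [σ]
      cases decide (i = i₀) <;> simp [Bool.toNat_le]
    · simp [σ]
    · intro i hi _
      have : i ≠ i₀ := fun h => hn (by rw [h] at hi; exact hi)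
      simp [σ, this]
  refine ⟨N.meanRate σ, hσ.meanRate_mem, ?_⟩
  rw [meanRate_one]
  have : ∑ k : Fin (q n 1), (σ.z ⟨(n, 1), k⟩).toNat = 1 := by
    rw [Finset.sum_eq_single ⟨0, by dsimp only [q]; omega⟩]
    · simp [σ, i₀]
    · intro k _ hk
      simpa [σ, i₀] using hk
    · simp
  rw [this]
  simp

/-- Some convex combination of saturated rates serves all joint queues that can be served. -/
theorem exists_joint_rates (N : CellNetwork V U) (A : Finset U)
    (hA : ∀ n ∈ A, 0 < N.S ∧ N.sec n ≠ none ∧ 0 < (N.p n 1 : ℝ)) :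
    ∃ r ∈ convexHull ℝ N.saturatedRates, ∀ n ∈ A, 0 < r n 1 := by
  induction A using Finset.induction_on with
  | empty =>
    exact ⟨_, subset_convexHull ℝ _ (feasible_empty (q := fun _ _ => 0)).meanRate_mem, by simp⟩
  | insert n A hn ih =>
    obtain ⟨r, hr, hrA⟩ := ih fun m hm => hA m (Finset.mem_insert_of_mem hm)
    obtain ⟨hS, hsec, hp⟩ := hA n (Finset.mem_insert_self n A)
    obtain ⟨e, he, hen⟩ := exists_joint_rate hS hsec
    have he' := subset_convexHull ℝ _ he
    refine ⟨(1 / 2 : ℝ) • r + (1 / 2 : ℝ) • e, convex_convexHull ℝ _ hr he' (by norm_num)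
      (by norm_num) (by norm_num), fun m hm => ?_⟩
    have h1 := convexHull_rate_nonneg hr m 1
    have h2 := convexHull_rate_nonneg he' m 1
    simp only [Pi.add_apply, Pi.smul_apply, smul_eq_mul]
    rcases Finset.mem_insert.1 hm with rfl | hm
    · rw [hen]
      linarith
    · linarith [hrA m hm]

/-- The weight of user `n` in the objective with utility `utilityQ`, for rates `r`. -/
def userWeight (q : QueueState U) (r : U → Fin 3 → ℝ) (n : U) : ℝ :=
  q n 0 * r n 0 + q n 1 * r n 1 + max ((q n 0 : ℝ) - q n 1) 0 * r n 2

theorem userWeight_nonneg {r : U → Fin 3 → ℝ} (hr : ∀ n j, 0 ≤ r n j) (q : QueueState U) (n : U) :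
    0 ≤ userWeight q r n := by
  have := hr n 0
  have := hr n 1
  have := hr n 2
  unfold userWeight
  positivity

/-- The part of the queue lengths of user `n` that is subject to a negative drift. -/
noncomputable def activeLength (N : CellNetwork V U) (q : QueueState U) (n : U) : ℝ :=
  q n 0 + if N.sec n = none then 0 else (q n 1 : ℝ)

theorem exists_rate_margin {lam : U → ℝ} (hlam : lam ∈ N.rateRegion) :
    ∃ r ∈ convexHull ℝ N.saturatedRates, ∃ κ > 0, ∀ (q : QueueState U) (n : U), 0 < lam n →
      lam n * q n 0 + κ * N.activeLength q n ≤ userWeight q r n := by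
  classical
  obtain ⟨-, f, ⟨hf0, hf⟩, r, hr, hfr⟩ := hlam
  obtain ⟨e, he, heA⟩ := exists_joint_rates N
    (Finset.univ.filter fun n => 0 < N.S ∧ N.sec n ≠ none ∧ 0 < (N.p n 1 : ℝ))
    fun n hn => (Finset.mem_filter.1 hn).2
  have hδ : ∃ δ : ℝ, (0 < δ ∧ δ < 1) ∧ ∀ n j, 0 < f n j → f n j < (1 - δ) * r n j := by
    have h1 : ∀ᶠ δ : ℝ in nhdsWithin 0 (Ioi 0),
        δ < 1 ∧ ∀ n j, 0 < f n j → f n j < (1 - δ) * r n j := by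
      refine Filter.Eventually.filter_mono nhdsWithin_le_nhds ?_
      refine (eventually_lt_nhds one_pos).and ?_
      refine Filter.eventually_all.2 fun n => Filter.eventually_all.2 fun j => ?_
      by_cases hpos : 0 < f n j
      · have hc : Continuous fun δ : ℝ => (1 - δ) * r n j := by fun_prop
        have h2 : f n j < (1 - (0 : ℝ)) * r n j := by simpa using hfr n j hpos
        filter_upwards [(hc.tendsto 0).eventually_const_lt h2] with δ hδ _ using hδ
      · exact Filter.Eventually.of_forall fun δ h => absurd h hpos
    obtain ⟨δ, hδ1, hδ2⟩ := (h1.and self_mem_nhdsWithin).exists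
    exact ⟨δ, ⟨hδ2, hδ1.1⟩, hδ1.2⟩
  obtain ⟨δ, ⟨hδ0, hδ1⟩, hδ⟩ := hδ
  set r' : U → Fin 3 → ℝ := (1 - δ) • r + δ • e with hr'
  have hr'mem : r' ∈ convexHull ℝ N.saturatedRates :=
    convex_convexHull ℝ _ hr he (by linarith) hδ0.le (by ring)
  have hval : ∀ n j, r' n j = (1 - δ) * r n j + δ * e n j := fun n j => rfl
  have hpos : ∀ n j, 0 < f n j → f n j < r' n j := fun n j h => by
    rw [hval]
    have := mul_nonneg hδ0.le (convexHull_rate_nonneg he n j)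
    linarith [hδ n j h]
  have hle : ∀ n j, f n j ≤ r' n j := fun n j => by
    rcases (hf0 n j).lt_or_eq with h | h
    · exact (hpos n j h).le
    · rw [← h]
      exact convexHull_rate_nonneg hr'mem n j
  have hκ : ∃ κ : ℝ, 0 < κ ∧ ∀ n j, f n j < r' n j → f n j + κ ≤ r' n j := by
    have h1 : ∀ᶠ κ : ℝ in nhdsWithin 0 (Ioi 0),
        ∀ n j, f n j < r' n j → f n j + κ ≤ r' n j := by
      refine Filter.Eventually.filter_mono nhdsWithin_le_nhds ?_
      refine Filter.eventually_all.2 fun n => Filter.eventually_all.2 fun j => ?_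
      by_cases hlt : f n j < r' n j
      · filter_upwards [eventually_lt_nhds (sub_pos.2 hlt)] with κ hκ _
        linarith
      · exact Filter.Eventually.of_forall fun δ h => absurd h hlt
    obtain ⟨κ, h1, h2⟩ := (h1.and self_mem_nhdsWithin).exists
    exact ⟨κ, h2, h1⟩
  obtain ⟨κ, hκ0, hκ⟩ := hκ
  refine ⟨r', hr'mem, κ / 2, by linarith, fun q n hn => ?_⟩
  have hL : (0 : ℝ) ≤ q n 0 := by positivity
  have hL' : (0 : ℝ) ≤ q n 1 := by positivity
  have hm0 : 0 ≤ max ((q n 0 : ℝ) - q n 1) 0 := le_max_right _ _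
  have hm1 : (q n 0 : ℝ) - q n 1 ≤ max ((q n 0 : ℝ) - q n 1) 0 := le_max_left _ _
  have hlam := hf n
  unfold userWeight activeLength
  set m := max ((q n 0 : ℝ) - q n 1) 0
  set a : ℝ := ((q n 0 : ℕ) : ℝ)
  set b : ℝ := ((q n 1 : ℕ) : ℝ)
  have hf2 := mul_le_mul_of_nonneg_left hm1 (hf0 n 2)
  have key2 := mul_le_mul_of_nonneg_left (hle n 2) hm0
  rcases (hf0 n 0).lt_or_eq with h0 | h0
  · have key0 := mul_le_mul_of_nonneg_left (hκ n 0 (hpos n 0 h0)) hL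
    by_cases hsec : N.sec n = none
    · rw [if_pos hsec]
      have key1 := mul_le_mul_of_nonneg_left (hle n 1) hL'
      have hz : f n 1 = 0 := by
        have := convexHull_rate_one_le_zero hr'mem hsec
        exact le_antisymm ((hle n 1).trans this) (hf0 n 1)
      have hz2 : f n 2 = 0 := by rw [hlam.2, hz]
      rw [hz] at key1
      rw [hz2] at key2
      have := mul_nonneg hκ0.le hL
      rw [hlam.1, hz2]
      linarith
    · rw [if_neg hsec]
      have h1 : f n 1 < r' n 1 := by
        rcases (hf0 n 1).lt_or_eq with h | h
        · exact hpos n 1 h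
        · have hS : 0 < (N.S : ℝ) * N.p n 0 :=
            (h0.trans (hfr n 0 h0)).trans_le (convexHull_rate_zero_le hr n)
          have hS0 : 0 < N.S := by
            rcases Nat.eq_zero_or_pos N.S with h | h
            · simp [h] at hS
            · exact h
          have hp0 : 0 < (N.p n 0 : ℝ) := (pos_iff_pos_of_mul_pos hS).1 (by positivity)
          have hp1 : 0 < (N.p n 1 : ℝ) :=
            hp0.trans_le (N.p_mono n (Option.isSome_iff_ne_none.2 hsec))
          have := heA n (Finset.mem_filter.2 ⟨Finset.mem_univ _, hS0, hsec, hp1⟩)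
          rw [← h, hval]
          have h3 := mul_nonneg (sub_nonneg.2 hδ1.le) (convexHull_rate_nonneg hr n 1)
          have h4 := mul_pos hδ0 this
          linarith
      have key1 := mul_le_mul_of_nonneg_left (hκ n 1 h1) hL'
      have := mul_nonneg hκ0.le hL
      have := mul_nonneg hκ0.le hL'
      rw [hlam.1]
      rw [← hlam.2] at key1
      linarith
  · have hf2pos : 0 < f n 2 := by
      have := hlam.1
      linarith
    have hf1pos : 0 < f n 1 := hlam.2 ▸ hf2pos
    have hsec : N.sec n ≠ none := fun h => by
      have := convexHull_rate_one_le_zero hr'mem h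
      linarith [hpos n 1 hf1pos]
    rw [if_neg hsec]
    have key1 := mul_le_mul_of_nonneg_left (hκ n 1 (hpos n 1 hf1pos)) hL'
    have key2 := mul_le_mul_of_nonneg_left (hκ n 2 (hpos n 2 hf2pos)) hm0
    have key0 := mul_le_mul_of_nonneg_left (hle n 0) hL
    have h5 := mul_le_mul_of_nonneg_left hm1 hκ0.le
    have h6 := mul_nonneg hκ0.le hm0
    have h7 := mul_nonneg hκ0.le hL'
    rw [hlam.1]
    rw [← hlam.2] at key1
    rw [← h0] at key0 ⊢
    linarith

/-! ### Optimal schedules -/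

theorem Feasible.objective_utilityQ {σ : Schedule N.S q} (hσ : N.Feasible σ) :
    N.objective N.utilityQ σ = ∑ n, userWeight q (N.meanRate σ) n := by
  unfold objective
  rw [Fintype.sum_sigma, Fintype.sum_prod_type]
  refine Finset.sum_congr rfl fun n _ => ?_
  rw [Fin.sum_univ_two]
  have hy : ∀ k, σ.y ⟨(n, 1), k⟩ = false := fun k => hσ.no_second_forward ⟨(n, 1), k⟩ rfl
  simp only [hy, utilityQ, userWeight, meanRate_zero, meanRate_one, meanRate_two, forwarded,
    Finset.sum_add_distrib, Nat.cast_sum, Finset.mul_sum, Finset.sum_mul]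
  simp only [Fin.isValue, one_ne_zero, ↓reduceIte, Bool.toNat_false, Nat.cast_zero, zero_mul,
    Finset.sum_const_zero, add_zero]
  have h1 : ∀ a b c d e f : ℝ, a = d → b = f → c = e → a + b + c = d + e + f := by
    rintro a b c d e f rfl rfl rfl
    ring
  refine h1 _ _ _ _ _ _ ?_ ?_ ?_ <;> exact Finset.sum_congr rfl fun k _ => by ring

/-- Up to a constant, an optimal schedule is as good as any point of the saturated rate region. -/
theorem IsOptimal.weight_le {σ : Schedule N.S q} (hσ : N.IsOptimal N.utilityQ σ)
    {r : U → Fin 3 → ℝ} (hr : r ∈ convexHull ℝ N.saturatedRates) :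
    ∑ n, userWeight q r n ≤ ∑ n, userWeight q (N.meanRate σ) n +
      Fintype.card U * (3 * ((N.S + N.K : ℕ) : ℝ) ^ 2) := by
  have hlin : IsLinearMap ℝ fun r : U → Fin 3 → ℝ => ∑ n, userWeight q r n := by
    constructor
    · intro r s
      rw [← Finset.sum_add_distrib]
      exact Finset.sum_congr rfl fun n _ => by simp only [userWeight, Pi.add_apply]; ring
    · intro c r
      rw [smul_eq_mul, Finset.mul_sum]
      exact Finset.sum_congr rfl fun n _ => by
        simp only [userWeight, Pi.smul_apply, smul_eq_mul]; ring
  refine convexHull_min (t := {r | ∑ n, userWeight q r n ≤ _}) ?_ (convex_halfSpace_le hlin _) hr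
  rintro r ⟨q', -, τ', hτ', rfl⟩
  obtain ⟨τ, hτ, h⟩ := hτ'.exists_transfer_meanRate q
  have hopt := hσ.2 τ hτ
  rw [hτ.objective_utilityQ, hσ.1.objective_utilityQ] at hopt
  have hterm : ∀ n, userWeight q (N.meanRate τ') n ≤ userWeight q (N.meanRate τ) n +
      3 * ((N.S + N.K : ℕ) : ℝ) ^ 2 := by
    intro n
    have hgen : ∀ (j : Fin 3) (w : ℝ) (L : ℕ), 0 ≤ w → w ≤ L →
        (N.S + N.K ≤ L → N.meanRate τ n j = N.meanRate τ' n j) →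
        w * N.meanRate τ' n j ≤ w * N.meanRate τ n j + ((N.S + N.K : ℕ) : ℝ) ^ 2 := by
      intro j w L hw hwL hL
      by_cases hc : N.S + N.K ≤ L
      · rw [hL hc]
        have := sq_nonneg ((N.S + N.K : ℕ) : ℝ)
        linarith
      · have h1 : w ≤ ((N.S + N.K : ℕ) : ℝ) := hwL.trans (Nat.cast_le.2 (not_le.1 hc).le)
        have h2 : N.meanRate τ' n j ≤ ((N.S + N.K : ℕ) : ℝ) := by
          simpa using hτ'.meanRate_le n j
        have h3 := mul_le_mul h1 h2 (N.meanRate_nonneg τ' n j) (hw.trans h1)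
        have h4 := mul_nonneg hw (N.meanRate_nonneg τ n j)
        linarith
    have h0 := hgen 0 (q n 0) (q n 0) (by positivity) le_rfl fun hL => ((h n).1 hL).1
    have h1 := hgen 1 (q n 1) (q n 1) (by positivity) le_rfl fun hL => (h n).2 hL
    have h2 := hgen 2 (max ((q n 0 : ℝ) - q n 1) 0) (q n 0) (le_max_right _ _)
      (max_le (by simp) (by positivity)) fun hL => ((h n).1 hL).2
    unfold userWeight
    linarith
  calc ∑ n, userWeight q (N.meanRate τ') n
      ≤ ∑ n, (userWeight q (N.meanRate τ) n + 3 * ((N.S + N.K : ℕ) : ℝ) ^ 2) :=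
        Finset.sum_le_sum fun n _ => hterm n
    _ = ∑ n, userWeight q (N.meanRate τ) n +
        Fintype.card U * (3 * ((N.S + N.K : ℕ) : ℝ) ^ 2) := by
        rw [Finset.sum_add_distrib]
        simp
    _ ≤ _ := by linarith

/-- If nothing is forwarded from a shorter to a longer queue, the truncation in `utilityQ` does not
matter. -/
theorem userWeight_of_noBackward {σ : Schedule N.S q}
    (h : ∀ i, σ.y i = true → q i.1.1 1 ≤ q i.1.1 0) (n : U) :
    userWeight q (N.meanRate σ) n = q n 0 * N.meanRate σ n 0 + q n 1 * N.meanRate σ n 1 +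
      ((q n 0 : ℝ) - q n 1) * N.meanRate σ n 2 := by
  unfold userWeight
  by_cases hn : q n 1 ≤ q n 0
  · rw [max_eq_left (sub_nonneg.2 (Nat.cast_le.2 hn))]
  · have : N.meanRate σ n 2 = 0 := by
      rw [meanRate_two, forwarded, Nat.cast_eq_zero]
      refine Finset.sum_eq_zero fun k _ => ?_
      have : σ.y ⟨(n, 0), k⟩ = false := by
        by_contra hcon
        exact hn (h ⟨(n, 0), k⟩ (by simpa using hcon))
      simp [this]
    simp [this]

end CellNetwork

namespace CellNetwork

variable {V U : Type*} [DecidableEq V] [Fintype U] [DecidableEq U]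
variable {N : CellNetwork V U} {q q' : QueueState U} {ν : U → PMF ℕ}

/-! ### Drift of the sum of squares -/

theorem expect_transition (N : CellNetwork V U) (π : N.Policy) (ν : U → PMF ℕ) (q : QueueState U)
    (g : QueueState U → ENNReal) :
    (N.transition π ν q).expect g = (π.law q).expect fun σ => (N.outcomeLaw q).expect fun Y =>
      (arrivalLaw ν).expect fun W => g (N.next σ Y W) := by
  simp only [transition, PMF.expect_bind, PMF.expect_map]

theorem mem_support_transition {π : N.Policy} (h : q' ∈ (N.transition π ν q).support) :
    ∃ σ ∈ (π.law q).support, ∃ Y, ∃ W ∈ (arrivalLaw ν).support, q' = N.next σ Y W := by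
  simp only [transition, PMF.mem_support_bind_iff, PMF.mem_support_map_iff] at h
  obtain ⟨σ, hσ, Y, -, W, hW, rfl⟩ := h
  exact ⟨σ, hσ, Y, W, hW, rfl⟩

theorem Feasible.next_sq_le {σ : Schedule N.S q} (hσ : N.Feasible σ) (Y : Packet q → Bool)
    (W : U → ℕ) (n : U) :
    (N.next σ Y W n 0) ^ 2 + (N.next σ Y W n 1) ^ 2 + (2 * q n 0 * N.served σ Y n 0 +
        2 * q n 0 * N.forwarded σ n + 2 * q n 1 * N.served σ Y n 1) ≤
      (q n 0) ^ 2 + (q n 1) ^ 2 + (2 * q n 0 * W n + 2 * q n 1 * N.forwarded σ n) +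
        ((W n) ^ 2 + 3 * (N.S + N.K) ^ 2) := by
  have h0 := N.served_add_forwarded_le hσ Y n
  have h1 := N.served_le σ Y n 1
  have hS0 := hσ.served_le_S Y n 0
  have hS1 := hσ.served_le_S Y n 1
  have hK := hσ.forwarded_le n
  simp only [next, Matrix.cons_val_zero, Matrix.cons_val_one]
  generalize N.served σ Y n 0 = s₀ at *
  generalize N.served σ Y n 1 = s₁ at *
  generalize N.forwarded σ n = f at *
  obtain ⟨d, hd⟩ := Nat.exists_eq_add_of_le h0
  obtain ⟨e, he⟩ := Nat.exists_eq_add_of_le h1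
  rw [hd, he, Nat.add_sub_cancel_left, Nat.add_sub_cancel_left]
  have ha : (s₀ + f) ^ 2 ≤ (N.S + N.K) ^ 2 := Nat.pow_le_pow_left (by omega) 2
  have hb : f ^ 2 ≤ (N.S + N.K) ^ 2 := Nat.pow_le_pow_left (by omega) 2
  have hc : s₁ ^ 2 ≤ (N.S + N.K) ^ 2 := Nat.pow_le_pow_left (by omega) 2
  have hx : 0 ≤ (s₀ + f) * W n := Nat.zero_le _
  have hy : 0 ≤ s₁ * f := Nat.zero_le _
  nlinarith

/-- The sum of the squared queue lengths. -/
noncomputable def sqLength (q : QueueState U) : ENNReal :=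
  ∑ n, ((q n 0 : ENNReal) ^ 2 + (q n 1 : ENNReal) ^ 2)

theorem sqLength_ne_top (q : QueueState U) : sqLength q ≠ ⊤ := by
  simp [sqLength]

/-- The constant in the drift inequality of user `n`. -/
noncomputable def driftConst (N : CellNetwork V U) (ν : U → PMF ℕ) (n : U) : ENNReal :=
  (ν n).expect (fun k => (k : ENNReal) ^ 2) + 3 * (N.S + N.K) ^ 2

theorem Feasible.expect_next_sq_le {σ : Schedule N.S q} (hσ : N.Feasible σ)
    (hν : FiniteSecondMoment ν) (n : U) :
    ((N.outcomeLaw q).expect fun Y => (arrivalLaw ν).expect fun W =>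
        (N.next σ Y W n 0 : ENNReal) ^ 2 + (N.next σ Y W n 1 : ENNReal) ^ 2) +
      ENNReal.ofReal (2 * q n 0 * N.meanRate σ n 0 + 2 * q n 0 * N.meanRate σ n 2 +
        2 * q n 1 * N.meanRate σ n 1) ≤
      ((q n 0 : ENNReal) ^ 2 + (q n 1 : ENNReal) ^ 2) +
        ENNReal.ofReal (2 * q n 0 * arrivalRate ν n + 2 * q n 1 * N.meanRate σ n 2) +
          N.driftConst ν n := by
  have hp : ∀ Y W, ((N.next σ Y W n 0 : ENNReal) ^ 2 + (N.next σ Y W n 1 : ENNReal) ^ 2) +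
      (2 * q n 0 * N.served σ Y n 0 + 2 * q n 0 * N.forwarded σ n +
        2 * q n 1 * N.served σ Y n 1) ≤
      ((q n 0 : ENNReal) ^ 2 + (q n 1 : ENNReal) ^ 2) +
        (2 * q n 0 * W n + 2 * q n 1 * N.forwarded σ n) +
        ((W n : ENNReal) ^ 2 + 3 * (N.S + N.K) ^ 2) := fun Y W => by
    exact_mod_cast hσ.next_sq_le Y W n
  have h := (N.outcomeLaw q).expect_mono fun Y => (arrivalLaw ν).expect_mono fun W => hp Y W
  have hW1 : (arrivalLaw ν).expect (fun W => (W n : ENNReal)) =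
      ENNReal.ofReal (arrivalRate ν n) :=
    (expect_arrivalLaw ν n fun k => (k : ENNReal)).trans (expect_arrivalRate hν n)
  have hW2 : (arrivalLaw ν).expect (fun W => (W n : ENNReal) ^ 2) =
      (ν n).expect fun k => (k : ENNReal) ^ 2 :=
    expect_arrivalLaw ν n fun k => (k : ENNReal) ^ 2
  have hs0 : (N.outcomeLaw q).expect (fun Y => (N.served σ Y n 0 : ENNReal)) =
      ENNReal.ofReal (N.meanRate σ n 0) := by
    rw [expect_served, meanRate_zero]
  have hs1 : (N.outcomeLaw q).expect (fun Y => (N.served σ Y n 1 : ENNReal)) =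
      ENNReal.ofReal (N.meanRate σ n 1) := by
    rw [expect_served, meanRate_one]
  have hf : (N.forwarded σ n : ENNReal) = ENNReal.ofReal (N.meanRate σ n 2) := by
    rw [meanRate_two, ENNReal.ofReal_natCast]
  simp only [PMF.expect_add, PMF.expect_const_mul, PMF.expect_const, hW1, hW2, hs0, hs1, hf] at h
  have r0 := N.meanRate_nonneg σ n 0
  have r1 := N.meanRate_nonneg σ n 1
  have r2 := N.meanRate_nonneg σ n 2
  have hl := arrivalRate_nonneg ν n
  have two : ENNReal.ofReal 2 = 2 := by simp
  simp only [PMF.expect_add]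
  rw [ENNReal.ofReal_add (by positivity) (by positivity),
    ENNReal.ofReal_add (by positivity) (by positivity),
    ENNReal.ofReal_add (by positivity) (by positivity)]
  simp only [ENNReal.ofReal_mul (show (0 : ℝ) ≤ 2 by norm_num),
    ENNReal.ofReal_mul (show (0 : ℝ) ≤ 2 * (q n 0 : ℝ) by positivity),
    ENNReal.ofReal_mul (show (0 : ℝ) ≤ 2 * (q n 1 : ℝ) by positivity), two,
    ENNReal.ofReal_natCast]
  exact h

/-- The total length of the queues that are subject to a negative drift. -/
noncomputable def activeTotal (N : CellNetwork V U) (ν : U → PMF ℕ) (q : QueueState U) : ℝ :=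
  ∑ n with 0 < arrivalRate ν n, N.activeLength q n

theorem activeLength_nonneg (N : CellNetwork V U) (q : QueueState U) (n : U) :
    0 ≤ N.activeLength q n := by
  unfold activeLength
  split_ifs <;> positivity

/-- The drift inequality for a schedule chosen by an exact policy. -/
theorem IsOptimal.expect_sqLength_le {σ : Schedule N.S q} (hσ : N.IsOptimal N.utilityQ σ)
    (hback : ∀ i, σ.y i = true → q i.1.1 1 ≤ q i.1.1 0) (hν : FiniteSecondMoment ν)
    {r : U → Fin 3 → ℝ} (hr : r ∈ convexHull ℝ N.saturatedRates) {κ : ℝ} (hκ0 : 0 < κ)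
    (hκ : ∀ (q : QueueState U) (n : U), 0 < arrivalRate ν n →
      arrivalRate ν n * q n 0 + κ * N.activeLength q n ≤ userWeight q r n) :
    ((N.outcomeLaw q).expect fun Y => (arrivalLaw ν).expect fun W => sqLength (N.next σ Y W)) +
      ENNReal.ofReal (2 * κ * N.activeTotal ν q) ≤
      sqLength q + (∑ n, N.driftConst ν n +
        ENNReal.ofReal (2 * (Fintype.card U * (3 * ((N.S + N.K : ℕ) : ℝ) ^ 2)))) := by
  set A : U → ℝ := fun n => 2 * q n 0 * N.meanRate σ n 0 + 2 * q n 0 * N.meanRate σ n 2 +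
    2 * q n 1 * N.meanRate σ n 1 with hA
  set B : U → ℝ := fun n => 2 * q n 0 * arrivalRate ν n + 2 * q n 1 * N.meanRate σ n 2 with hB
  set c : ℝ := Fintype.card U * (3 * ((N.S + N.K : ℕ) : ℝ) ^ 2) with hc
  have hA0 : ∀ n, 0 ≤ A n := fun n => by
    have r0 := N.meanRate_nonneg σ n 0
    have r1 := N.meanRate_nonneg σ n 1
    have r2 := N.meanRate_nonneg σ n 2
    dsimp only [A]
    positivity
  have hB0 : ∀ n, 0 ≤ B n := fun n => by
    have r2 := N.meanRate_nonneg σ n 2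
    have hl := arrivalRate_nonneg ν n
    dsimp only [B]
    positivity
  have hc0 : 0 ≤ c := by positivity
  have hG0 : 0 ≤ N.activeTotal ν q := Finset.sum_nonneg fun n _ => N.activeLength_nonneg q n
  have hreal : ∑ n, B n + 2 * κ * N.activeTotal ν q ≤ ∑ n, A n + 2 * c := by
    have h1 := hσ.weight_le hr
    have h2 : ∑ n, arrivalRate ν n * q n 0 + κ * N.activeTotal ν q ≤ ∑ n, userWeight q r n := by
      rw [activeTotal, Finset.mul_sum, Finset.sum_filter, ← Finset.sum_add_distrib]
      refine Finset.sum_le_sum fun n _ => ?_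
      split_ifs with hn
      · exact hκ q n hn
      · rw [le_antisymm (not_lt.1 hn) (arrivalRate_nonneg ν n), zero_mul, zero_add]
        exact userWeight_nonneg (convexHull_rate_nonneg hr) q n
    have h3 : ∑ n, A n - ∑ n, B n =
        2 * ∑ n, userWeight q (N.meanRate σ) n - 2 * ∑ n, arrivalRate ν n * q n 0 := by
      rw [Finset.mul_sum, Finset.mul_sum, ← Finset.sum_sub_distrib, ← Finset.sum_sub_distrib]
      refine Finset.sum_congr rfl fun n _ => ?_
      rw [userWeight_of_noBackward hback]
      simp only [hA, hB]
      ring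
    linarith
  have hsum := Finset.sum_le_sum fun n (_ : n ∈ Finset.univ) => hσ.1.expect_next_sq_le hν n
  simp only [Finset.sum_add_distrib] at hsum
  rw [← ENNReal.ofReal_sum_of_nonneg fun n _ => hA0 n,
    ← ENNReal.ofReal_sum_of_nonneg fun n _ => hB0 n] at hsum
  have hE : ((N.outcomeLaw q).expect fun Y => (arrivalLaw ν).expect fun W =>
      sqLength (N.next σ Y W)) = ∑ n, (N.outcomeLaw q).expect fun Y => (arrivalLaw ν).expect
        fun W => (N.next σ Y W n 0 : ENNReal) ^ 2 + (N.next σ Y W n 1 : ENNReal) ^ 2 := by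
    simp only [sqLength, PMF.expect_sum]
  have hV : sqLength q = ∑ n, (q n 0 : ENNReal) ^ 2 + ∑ n, (q n 1 : ENNReal) ^ 2 := by
    rw [sqLength, Finset.sum_add_distrib]
  rw [← hV, ← hE] at hsum
  refine (ENNReal.add_le_add_iff_right (ENNReal.ofReal_ne_top (r := ∑ n, A n))).1 ?_
  have hreal' : ENNReal.ofReal (∑ n, B n) + ENNReal.ofReal (2 * κ * N.activeTotal ν q) ≤
      ENNReal.ofReal (∑ n, A n) + ENNReal.ofReal (2 * c) := by
    rw [← ENNReal.ofReal_add (Finset.sum_nonneg fun n _ => hB0 n) (by positivity),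
      ← ENNReal.ofReal_add (Finset.sum_nonneg fun n _ => hA0 n) (by positivity)]
    exact ENNReal.ofReal_le_ofReal hreal
  calc _ + ENNReal.ofReal (2 * κ * N.activeTotal ν q) + ENNReal.ofReal (∑ n, A n)
      = _ + ENNReal.ofReal (∑ n, A n) + ENNReal.ofReal (2 * κ * N.activeTotal ν q) := by ring
    _ ≤ sqLength q + ENNReal.ofReal (∑ n, B n) + ∑ n, N.driftConst ν n +
          ENNReal.ofReal (2 * κ * N.activeTotal ν q) := by gcongr
    _ = sqLength q + ∑ n, N.driftConst ν n +
          (ENNReal.ofReal (∑ n, B n) + ENNReal.ofReal (2 * κ * N.activeTotal ν q)) := by ring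
    _ ≤ sqLength q + ∑ n, N.driftConst ν n +
          (ENNReal.ofReal (∑ n, A n) + ENNReal.ofReal (2 * c)) := by gcongr
    _ = _ := by ring

/-! ### Queues without drift -/

/-- The states whose queues without drift have length at most `M`: these are the queues of the users
without arrivals, and the joint queues of the users without a secondary base station. -/
def inertBounded (N : CellNetwork V U) (ν : U → PMF ℕ) (M : ℕ) : Set (QueueState U) :=
  {q | ∀ n, (arrivalRate ν n = 0 → q n 0 + q n 1 ≤ M) ∧ (N.sec n = none → q n 1 ≤ M)}

theorem exists_mem_inertBounded (N : CellNetwork V U) (ν : U → PMF ℕ) (q : QueueState U) :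
    ∃ M, q ∈ N.inertBounded ν M := by
  have h : ∀ n, q n 0 + q n 1 ≤ ∑ n, (q n 0 + q n 1) := fun n =>
    Finset.single_le_sum (f := fun n => q n 0 + q n 1) (fun _ _ => Nat.zero_le _)
      (Finset.mem_univ n)
  exact ⟨∑ n, (q n 0 + q n 1), fun n => ⟨fun _ => h n, fun _ => le_of_add_le_right (h n)⟩⟩

theorem arrival_eq_zero (hν : FiniteSecondMoment ν) {n : U} (hn : arrivalRate ν n = 0) {W : U → ℕ}
    (hW : W ∈ (arrivalLaw ν).support) : W n = 0 := by
  have h := (expect_arrivalLaw ν n fun k => (k : ENNReal)).trans (expect_arrivalRate hν n)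
  rw [hn, ENNReal.ofReal_zero, PMF.expect, ENNReal.tsum_eq_zero] at h
  have hWn := h W
  rw [mul_eq_zero] at hWn
  rcases hWn with h' | h'
  · exact absurd h' (((arrivalLaw ν).mem_support_iff W).1 hW)
  · exact_mod_cast h'

theorem inertBounded_of_transition {π : N.Policy} (hν : FiniteSecondMoment ν) {M : ℕ}
    (hq : q ∈ N.inertBounded ν M) (h : q' ∈ (N.transition π ν q).support) :
    q' ∈ N.inertBounded ν M := by
  obtain ⟨σ, hσ, Y, W, hW, rfl⟩ := mem_support_transition h
  have hfeas := π.feasible q σ hσ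
  intro n
  have h0 := N.served_add_forwarded_le hfeas Y n
  have h1 := N.served_le σ Y n 1
  simp only [next, Matrix.cons_val_zero, Matrix.cons_val_one]
  refine ⟨fun hn => ?_, fun hn => ?_⟩
  · have := (hq n).1 hn
    rw [arrival_eq_zero hν hn hW]
    omega
  · have := (hq n).2 hn
    have hf : N.forwarded σ n = 0 :=
      Finset.sum_eq_zero fun k _ => by simp [hfeas.no_secondary_forward ⟨(n, 0), k⟩ hn]
    omega

theorem finite_inertBounded (N : CellNetwork V U) (ν : U → PMF ℕ) (M : ℕ) (c : ℝ) :
    {q | q ∈ N.inertBounded ν M ∧ N.activeTotal ν q ≤ c}.Finite := by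
  refine (Set.finite_Icc (0 : QueueState U) fun _ _ => M + ⌈c⌉₊).subset ?_
  rintro q ⟨hq, hc⟩
  have hact : ∀ n, 0 < arrivalRate ν n → N.activeLength q n ≤ (⌈c⌉₊ : ℝ) := fun n hn =>
    ((Finset.single_le_sum (f := fun n => N.activeLength q n)
      (fun n _ => N.activeLength_nonneg q n)
      (Finset.mem_filter.2 ⟨Finset.mem_univ n, hn⟩)).trans hc).trans (Nat.le_ceil c)
  refine ⟨fun n β => Nat.zero_le _, fun n β => ?_⟩
  have hgoal : q n 0 ≤ M + ⌈c⌉₊ ∧ q n 1 ≤ M + ⌈c⌉₊ := by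
    rcases (arrivalRate_nonneg ν n).lt_or_eq with hn | hn
    · have h1 := hact n hn
      unfold activeLength at h1
      by_cases hs : N.sec n = none
      · rw [if_pos hs, add_zero, Nat.cast_le] at h1
        have := (hq n).2 hs
        omega
      · rw [if_neg hs] at h1
        have h2 : q n 0 + q n 1 ≤ ⌈c⌉₊ := by exact_mod_cast h1
        omega
    · have := (hq n).1 hn.symm
      omega
  match β with
  | 0 => exact hgoal.1
  | 1 => exact hgoal.2

theorem Policy.IsExactQ.isPosRec {π : N.Policy} (hπ : π.IsExactQ) (hν : FiniteSecondMoment ν)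
    (hrate : arrivalRate ν ∈ N.rateRegion) : IsPosRec (N.transition π ν) := by
  classical
  intro q₀
  obtain ⟨r, hr, κ, hκ0, hκ⟩ := exists_rate_margin hrate
  obtain ⟨M, hM⟩ := N.exists_mem_inertBounded ν q₀
  set C : ENNReal := ∑ n, N.driftConst ν n +
    ENNReal.ofReal (2 * (Fintype.card U * (3 * ((N.S + N.K : ℕ) : ℝ) ^ 2))) with hCdef
  have hC : C ≠ ⊤ := by
    refine ENNReal.add_ne_top.2 ⟨ENNReal.sum_ne_top.2 fun n _ => ?_, ENNReal.ofReal_ne_top⟩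
    refine ENNReal.add_ne_top.2 ⟨expect_sq_ne_top hν n, ?_⟩
    exact_mod_cast ENNReal.natCast_ne_top (3 * (N.S + N.K) ^ 2)
  have hdrift : ∀ q, (N.transition π ν q).expect sqLength +
      ENNReal.ofReal (2 * κ * N.activeTotal ν q) ≤ sqLength q + C := by
    intro q
    rw [expect_transition, ← (π.law q).expect_const (ENNReal.ofReal _), ← PMF.expect_add,
      ← (π.law q).expect_const (sqLength q + C)]
    exact (π.law q).expect_mono_support fun σ hσ =>
      (hπ q σ hσ).1.expect_sqLength_le (hπ q σ hσ).2 hν hr hκ0 hκ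
  let Lyap : QueueState U → ENNReal := fun q => if q ∈ N.inertBounded ν M then sqLength q else ⊤
  refine posRecFrom_of_drift _ (V := Lyap) (C := C + 1)
    (F := (N.finite_inertBounded ν M ((C.toReal + 1) / (2 * κ))).toFinset)
    (ENNReal.add_ne_top.2 ⟨hC, ENNReal.one_ne_top⟩) (fun q => ?_) (x := q₀) ?_
  · by_cases hq : q ∈ N.inertBounded ν M
    · have h1 : (N.transition π ν q).expect Lyap = (N.transition π ν q).expect sqLength :=
        PMF.expect_congr_support _ fun q' hq' => if_pos (inertBounded_of_transition hν hq hq')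
      rw [h1, Set.Finite.coe_toFinset]
      simp only [Lyap, if_pos hq]
      have h2 := hdrift q
      by_cases hF : N.activeTotal ν q ≤ (C.toReal + 1) / (2 * κ)
      · rw [Set.indicator_of_mem (show q ∈ {q | q ∈ N.inertBounded ν M ∧ N.activeTotal ν q ≤ _} from
          ⟨hq, hF⟩), ← add_assoc]
        gcongr
        exact le_self_add.trans h2
      · rw [Set.indicator_of_notMem (fun h => hF h.2), add_zero]
        have h3 : C + 1 ≤ ENNReal.ofReal (2 * κ * N.activeTotal ν q) := by
          rw [not_le, div_lt_iff₀ (by positivity)] at hF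
          rw [← ENNReal.ofReal_toReal hC, ← ENNReal.ofReal_one,
            ← ENNReal.ofReal_add ENNReal.toReal_nonneg zero_le_one]
          exact ENNReal.ofReal_le_ofReal (by linarith)
        refine (ENNReal.add_le_add_iff_right hC).1 (le_trans ?_ h2)
        rw [add_assoc, add_comm 1]
        gcongr
    · simp [Lyap, if_neg hq]
  · simp only [Lyap, if_pos hM]
    exact sqLength_ne_top q₀

end CellNetwork

/-- If the truncations of `a` and `b` at any level have the same expectation, then upward and
downward moves from `a` to `b` balance, even if `a` and `b` have infinite expectations. -/
theorem PMF.expect_balance {Ω : Type*} (p : PMF Ω) {a b up dn : Ω → ℕ}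
    (h : ∀ M : ℕ, p.expect (fun ω => ((min (b ω) M : ℕ) : ENNReal)) =
      p.expect fun ω => ((min (a ω) M : ℕ) : ENNReal))
    (hmove : ∀ ω ∈ p.support, b ω + dn ω = a ω + up ω)
    (hdn : p.expect (fun ω => (dn ω : ENNReal)) ≠ ⊤) :
    p.expect (fun ω => (up ω : ENNReal)) = p.expect fun ω => (dn ω : ENNReal) := by
  have hsup : ∀ a b : Ω → ℕ, p.expect (fun ω => ((b ω - a ω : ℕ) : ENNReal)) =
      ⨆ M : ℕ, p.expect fun ω => ((min (b ω) M - min (a ω) M : ℕ) : ENNReal) := by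
    intro a b
    rw [← PMF.expect_iSup]
    · congr 1
      funext ω
      refine le_antisymm (le_iSup_of_le (b ω) ?_) (iSup_le fun M => ?_)
      · exact Nat.cast_le.2 (by omega)
      · exact Nat.cast_le.2 (by omega)
    · intro M M' hM ω
      exact Nat.cast_le.2 (by omega)
  have hM : ∀ M : ℕ, p.expect (fun ω => ((min (b ω) M - min (a ω) M : ℕ) : ENNReal)) =
      p.expect fun ω => ((min (a ω) M - min (b ω) M : ℕ) : ENNReal) := by
    intro M
    have hfin : p.expect (fun ω => ((min (a ω) M : ℕ) : ENNReal)) ≠ ⊤ := by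
      refine ne_top_of_le_ne_top (ENNReal.natCast_ne_top M) ?_
      refine (p.expect_mono fun ω => ?_).trans (p.expect_const _).le
      exact Nat.cast_le.2 (min_le_right _ _)
    refine (ENNReal.add_right_inj hfin).1 ?_
    nth_rewrite 2 [← h M]
    rw [← PMF.expect_add, ← PMF.expect_add]
    congr 1
    funext ω
    rw [← Nat.cast_add, ← Nat.cast_add, Nat.cast_inj]
    omega
  have hbal : p.expect (fun ω => ((b ω - a ω : ℕ) : ENNReal)) =
      p.expect fun ω => ((a ω - b ω : ℕ) : ENNReal) := by
    rw [hsup a b, hsup b a]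
    exact iSup_congr hM
  have hfin : p.expect (fun ω => ((a ω - b ω : ℕ) : ENNReal)) ≠ ⊤ := by
    refine ne_top_of_le_ne_top hdn (p.expect_mono_support fun ω hω => ?_)
    have := hmove ω hω
    exact Nat.cast_le.2 (by omega)
  refine (ENNReal.add_left_inj hfin).1 ?_
  nth_rewrite 2 [← hbal]
  rw [← PMF.expect_add, ← PMF.expect_add]
  refine p.expect_congr_support fun ω hω => ?_
  have := hmove ω hω
  rw [← Nat.cast_add, ← Nat.cast_add, Nat.cast_inj]
  omega

namespace CellNetwork

variable {V U : Type*} [DecidableEq V] [Fintype U] [DecidableEq U]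
variable {N : CellNetwork V U} {q q' : QueueState U} {ν : U → PMF ℕ}

/-! ### Rates under a stationary distribution -/

/-- The data of one subframe: queue lengths, schedule, transmission outcomes and arrivals. -/
abbrev Subframe (N : CellNetwork V U) :=
  Σ q : QueueState U, Schedule N.S q × (Packet q → Bool) × (U → ℕ)

/-- The joint law of the data of one subframe, when the queue lengths have law `m`. -/
noncomputable def subframeLaw (N : CellNetwork V U) (m : PMF (QueueState U)) (π : N.Policy)
    (ν : U → PMF ℕ) : PMF N.Subframe :=
  m.bind fun q => (π.law q).bind fun σ => (N.outcomeLaw q).bind fun Y =>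
    (arrivalLaw ν).map fun W => ⟨q, σ, Y, W⟩

/-- The joint law of queue lengths and schedule, when the queue lengths have law `m`. -/
noncomputable def scheduleLaw (N : CellNetwork V U) (m : PMF (QueueState U)) (π : N.Policy) :
    PMF (Σ q : QueueState U, Schedule N.S q) :=
  m.bind fun q => (π.law q).map fun σ => ⟨q, σ⟩

theorem expect_subframeLaw (m : PMF (QueueState U)) (π : N.Policy) (g : N.Subframe → ENNReal) :
    (N.subframeLaw m π ν).expect g = m.expect fun q => (π.law q).expect fun σ =>
      (N.outcomeLaw q).expect fun Y => (arrivalLaw ν).expect fun W => g ⟨q, σ, Y, W⟩ := by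
  simp only [subframeLaw, PMF.expect_bind, PMF.expect_map]

theorem expect_scheduleLaw (m : PMF (QueueState U)) (π : N.Policy)
    (g : (Σ q : QueueState U, Schedule N.S q) → ENNReal) :
    (N.scheduleLaw m π).expect g = m.expect fun q => (π.law q).expect fun σ => g ⟨q, σ⟩ := by
  simp only [scheduleLaw, PMF.expect_bind, PMF.expect_map]

theorem feasible_of_mem_scheduleLaw {m : PMF (QueueState U)} {π : N.Policy}
    {ω : Σ q : QueueState U, Schedule N.S q} (h : ω ∈ (N.scheduleLaw m π).support) :
    N.Feasible ω.2 := by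
  simp only [scheduleLaw, PMF.mem_support_bind_iff, PMF.mem_support_map_iff] at h
  obtain ⟨q, -, σ, hσ, rfl⟩ := h
  exact π.feasible q σ hσ

theorem feasible_of_mem_subframeLaw {m : PMF (QueueState U)} {π : N.Policy}
    {ω : N.Subframe} (h : ω ∈ (N.subframeLaw m π ν).support) : N.Feasible ω.2.1 := by
  simp only [subframeLaw, PMF.mem_support_bind_iff, PMF.mem_support_map_iff] at h
  obtain ⟨q, -, σ, hσ, Y, -, W, -, rfl⟩ := h
  exact π.feasible q σ hσ

theorem expect_next_of_stationary {m : PMF (QueueState U)} {π : N.Policy}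
    (hm : m.bind (N.transition π ν) = m) (g : QueueState U → ENNReal) :
    (N.subframeLaw m π ν).expect (fun ω => g (N.next ω.2.1 ω.2.2.1 ω.2.2.2)) =
      (N.subframeLaw m π ν).expect fun ω => g ω.1 := by
  have h := m.expect_bind (N.transition π ν) g
  rw [hm] at h
  simp only [expect_transition] at h
  rw [expect_subframeLaw, expect_subframeLaw, ← h]
  simp only [PMF.expect_const]

/-- In a stationary state the flows of all queues balance. -/
theorem flow_balance {m : PMF (QueueState U)} {π : N.Policy} (hν : FiniteSecondMoment ν)
    (hm : m.bind (N.transition π ν) = m) (n : U) :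
    ENNReal.ofReal (arrivalRate ν n) =
      (N.scheduleLaw m π).expect (fun ω => ENNReal.ofReal (N.meanRate ω.2 n 0)) +
        (N.scheduleLaw m π).expect (fun ω => ENNReal.ofReal (N.meanRate ω.2 n 2)) ∧
    (N.scheduleLaw m π).expect (fun ω => ENNReal.ofReal (N.meanRate ω.2 n 2)) =
      (N.scheduleLaw m π).expect (fun ω => ENNReal.ofReal (N.meanRate ω.2 n 1)) := by
  have hW : (arrivalLaw ν).expect (fun W => (W n : ENNReal)) = ENNReal.ofReal (arrivalRate ν n) :=
    (expect_arrivalLaw ν n fun k => (k : ENNReal)).trans (expect_arrivalRate hν n)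
  have hWs : (N.subframeLaw m π ν).expect (fun ω => (ω.2.2.2 n : ENNReal)) =
      ENNReal.ofReal (arrivalRate ν n) := by
    rw [expect_subframeLaw]
    simp only [hW, PMF.expect_const]
  have hs0 : (N.subframeLaw m π ν).expect (fun ω => (N.served ω.2.1 ω.2.2.1 n 0 : ENNReal)) =
      (N.scheduleLaw m π).expect fun ω => ENNReal.ofReal (N.meanRate ω.2 n 0) := by
    rw [expect_subframeLaw, expect_scheduleLaw]
    simp only [PMF.expect_const, expect_served, meanRate_zero]
  have hs1 : (N.subframeLaw m π ν).expect (fun ω => (N.served ω.2.1 ω.2.2.1 n 1 : ENNReal)) =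
      (N.scheduleLaw m π).expect fun ω => ENNReal.ofReal (N.meanRate ω.2 n 1) := by
    rw [expect_subframeLaw, expect_scheduleLaw]
    simp only [PMF.expect_const, expect_served, meanRate_one]
  have hf : (N.subframeLaw m π ν).expect (fun ω => (N.forwarded ω.2.1 n : ENNReal)) =
      (N.scheduleLaw m π).expect fun ω => ENNReal.ofReal (N.meanRate ω.2 n 2) := by
    rw [expect_subframeLaw, expect_scheduleLaw]
    simp only [PMF.expect_const, meanRate_two, ENNReal.ofReal_natCast]
  have hbound : ∀ (g : N.Subframe → ℕ) (c : ℕ), (∀ ω ∈ (N.subframeLaw m π ν).support, g ω ≤ c) →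
      (N.subframeLaw m π ν).expect (fun ω => (g ω : ENNReal)) ≠ ⊤ := fun g c h => by
    refine ne_top_of_le_ne_top (ENNReal.natCast_ne_top c) ?_
    exact (PMF.expect_mono_support _ fun ω hω => Nat.cast_le.2 (h ω hω)).trans
      (PMF.expect_const _ _).le
  constructor
  · rw [← hWs, ← hs0, ← hf, ← PMF.expect_add]
    have h := (N.subframeLaw m π ν).expect_balance
      (a := fun ω => ω.1 n 0) (b := fun ω => N.next ω.2.1 ω.2.2.1 ω.2.2.2 n 0)
      (up := fun ω => ω.2.2.2 n)
      (dn := fun ω => N.served ω.2.1 ω.2.2.1 n 0 + N.forwarded ω.2.1 n)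
      (fun M => expect_next_of_stationary hm fun q => ((min (q n 0) M : ℕ) : ENNReal))
      (fun ω hω => by
        have := N.served_add_forwarded_le (feasible_of_mem_subframeLaw hω) ω.2.2.1 n
        simp only [next, Matrix.cons_val_zero]
        omega)
      (hbound _ (N.S + N.K) fun ω hω => add_le_add
        ((feasible_of_mem_subframeLaw hω).served_le_S _ n 0)
        ((feasible_of_mem_subframeLaw hω).forwarded_le n))
    simpa only [Nat.cast_add] using h
  · rw [← hs1, ← hf]
    exact (N.subframeLaw m π ν).expect_balance
      (a := fun ω => ω.1 n 1) (b := fun ω => N.next ω.2.1 ω.2.2.1 ω.2.2.2 n 1)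
      (up := fun ω => N.forwarded ω.2.1 n)
      (dn := fun ω => N.served ω.2.1 ω.2.2.1 n 1)
      (fun M => expect_next_of_stationary hm fun q => ((min (q n 1) M : ℕ) : ENNReal))
      (fun ω _ => by
        have := N.served_le ω.2.1 ω.2.2.1 n 1
        simp only [next, Matrix.cons_val_one, Matrix.cons_val_fin_one]
        omega)
      (hbound _ N.S fun ω hω => (feasible_of_mem_subframeLaw hω).served_le_S _ n 1)

/-- The mean rates of a policy under any law of the queue lengths are achievable in saturation. -/
theorem exists_mean_rates (m : PMF (QueueState U)) (π : N.Policy) :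
    ∃ f ∈ convexHull ℝ N.saturatedRates, ∀ n j, ENNReal.ofReal (f n j) =
      (N.scheduleLaw m π).expect fun ω => ENNReal.ofReal (N.meanRate ω.2 n j) := by
  let _ : MeasurableSpace (Σ q : QueueState U, Schedule N.S q) := ⊤
  set p := N.scheduleLaw m π
  let F : (Σ q : QueueState U, Schedule N.S q) → U → Fin 3 → ℝ := fun ω => N.meanRate ω.2
  have hae : ∀ᵐ ω ∂p.toMeasure, N.Feasible ω.2 := by
    rw [ae_iff, PMF.toMeasure_apply_eq_zero_iff _ MeasurableSpace.measurableSet_top]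
    exact Set.disjoint_left.2 fun ω hω h => h (feasible_of_mem_scheduleLaw hω)
  have hint : Integrable F p.toMeasure := by
    refine Integrable.of_bound (C := (N.S + N.K : ℝ))
      (Measurable.aestronglyMeasurable measurable_from_top) ?_
    filter_upwards [hae] with ω hω
    refine (pi_norm_le_iff_of_nonneg (by positivity)).2 fun n =>
      (pi_norm_le_iff_of_nonneg (by positivity)).2 fun j => ?_
    rw [Real.norm_of_nonneg (N.meanRate_nonneg _ n j)]
    exact hω.meanRate_le n j
  refine ⟨∫ ω, F ω ∂p.toMeasure, (convex_convexHull ℝ _).integral_mem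
    (N.saturatedRates_finite.isClosed_convexHull ℝ) ?_ hint, fun n j => ?_⟩
  · filter_upwards [hae] with ω hω
    exact subset_convexHull ℝ _ hω.meanRate_mem
  · have h1 : ∀ n, Integrable (fun ω => F ω n) p.toMeasure := fun n => hint.eval n
    rw [eval_integral h1, eval_integral fun j => (h1 n).eval j,
      ofReal_integral_eq_lintegral_ofReal ((h1 n).eval j)
        (ae_of_all _ fun ω => N.meanRate_nonneg ω.2 n j), PMF.expect_eq_lintegral]

theorem smul_mem_rateRegion {lam : U → ℝ} {f : U → Fin 3 → ℝ}
    (hf : f ∈ convexHull ℝ N.saturatedRates) (hlam : ∀ n, lam n = f n 0 + f n 2)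
    (hflow : ∀ n, f n 2 = f n 1) {t : ℝ} (ht0 : 0 ≤ t) (ht1 : t < 1) :
    t • lam ∈ N.rateRegion := by
  have hf0 := convexHull_rate_nonneg hf
  refine ⟨fun n => ?_, t • f, ⟨fun n j => mul_nonneg ht0 (hf0 n j), fun n => ⟨?_, ?_⟩⟩, f, hf,
    fun n j h => ?_⟩
  · have := hf0 n 0
    have := hf0 n 2
    simp only [Pi.smul_apply, smul_eq_mul, hlam n]
    positivity
  · simp only [Pi.smul_apply, smul_eq_mul, hlam n]
    ring
  · simp only [Pi.smul_apply, hflow n]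
  · simp only [Pi.smul_apply, smul_eq_mul] at h ⊢
    have : 0 < f n j := (pos_iff_pos_of_mul_pos h).1
      (ht0.lt_of_ne fun h0 => by simp [← h0] at h)
    nlinarith

/-- Under any policy, stability from some initial state forces the arrival rates into the closure
of the rate region. -/
theorem arrivalRate_mem_closure {π : N.Policy} (hν : FiniteSecondMoment ν)
    (h : PosRecFrom (N.transition π ν) q) : arrivalRate ν ∈ closure N.rateRegion := by
  obtain ⟨x, hx⟩ := h.exists_isPosRecState
  obtain ⟨m, hm⟩ := hx.exists_stationary
  obtain ⟨f, hf, hfE⟩ := exists_mean_rates m π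
  have hf0 := convexHull_rate_nonneg hf
  have hlam : ∀ n, arrivalRate ν n = f n 0 + f n 2 := fun n => by
    have := (flow_balance hν hm n).1
    rwa [← hfE, ← hfE, ← ENNReal.ofReal_add (hf0 n 0) (hf0 n 2),
      ENNReal.ofReal_eq_ofReal_iff (arrivalRate_nonneg ν n)
        (add_nonneg (hf0 n 0) (hf0 n 2))] at this
  have hflow : ∀ n, f n 2 = f n 1 := fun n => by
    have := (flow_balance hν hm n).2
    rwa [← hfE, ← hfE, ENNReal.ofReal_eq_ofReal_iff (hf0 n 2) (hf0 n 1)] at this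
  have hlim : Filter.Tendsto (fun t : ℝ => t • arrivalRate ν) (nhdsWithin 1 (Ico 0 1))
      (nhds (arrivalRate ν)) := by
    have hc : Continuous fun t : ℝ => t • arrivalRate ν := by fun_prop
    have := hc.tendsto 1
    rw [one_smul] at this
    exact this.mono_left nhdsWithin_le_nhds
  have hne : (nhdsWithin (1 : ℝ) (Ico 0 1)).NeBot := by
    rw [← mem_closure_iff_nhdsWithin_neBot, closure_Ico (by norm_num)]
    simp
  refine mem_closure_of_tendsto hlim ?_
  filter_upwards [self_mem_nhdsWithin] with t ht
  exact smul_mem_rateRegion hf hlam hflow ht.1 ht.2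

/-! ### Existence of exact policies and of arrival laws -/

theorem exists_exact_schedule (N : CellNetwork V U) (q : QueueState U) :
    ∃ σ : Schedule N.S q, N.IsOptimal N.utilityQ σ ∧ ∀ i, σ.y i = true → q i.1.1 1 ≤ q i.1.1 0 := by
  classical
  obtain ⟨σ, hσ, hmax⟩ := (Set.toFinite {σ : Schedule N.S q | N.Feasible σ}).exists_maximalFor
    (N.objective N.utilityQ) _ ⟨_, feasible_empty⟩
  have hopt : ∀ σ' : Schedule N.S q, N.Feasible σ' →
      N.objective N.utilityQ σ' ≤ N.objective N.utilityQ σ := fun σ' h' => by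
    rcases le_total (N.objective N.utilityQ σ') (N.objective N.utilityQ σ) with h | h
    · exact h
    · exact hmax h' h
  let τ : Schedule N.S q := ⟨σ.z, fun i => σ.y i && decide (q i.1.1 1 ≤ q i.1.1 0), σ.x⟩
  have hle : ∀ i, (τ.y i).toNat ≤ (σ.y i).toNat := fun i => by
    dsimp only [τ]
    cases σ.y i <;> simp [Bool.toNat_le]
  have hτ : N.Feasible τ :=
    { one_conf := fun i => (Nat.add_le_add_left (hle i) _).trans (hσ.one_conf i)
      subframe_cap := hσ.subframe_cap
      backhaul_cap := fun l hl =>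
        (Finset.sum_le_sum fun i _ => hle i).trans (hσ.backhaul_cap l hl)
      blocks := hσ.blocks
      no_second_forward := fun i hi => by simp [τ, hσ.no_second_forward i hi]
      used_once := hσ.used_once
      no_secondary_forward := fun i hi => by simp [τ, hσ.no_secondary_forward i hi]
      no_secondary_joint := hσ.no_secondary_joint }
  have hobj : N.objective N.utilityQ τ = N.objective N.utilityQ σ := by
    refine Finset.sum_congr rfl fun i _ => ?_
    by_cases hi : q i.1.1 1 ≤ q i.1.1 0
    · simp [τ, hi]
    · have : max ((q i.1.1 0 : ℝ) - q i.1.1 1) 0 = 0 :=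
        max_eq_right (sub_nonpos.2 (Nat.cast_le.2 (not_le.1 hi).le))
      simp [utilityQ, this, τ]
  refine ⟨τ, ⟨hτ, fun σ' h' => hobj ▸ hopt σ' h'⟩, fun i hi => ?_⟩
  simp only [τ, Bool.and_eq_true, decide_eq_true_eq] at hi
  exact hi.2

theorem exists_isExactQ (N : CellNetwork V U) : ∃ π : N.Policy, π.IsExactQ := by
  choose σ hσ hback using N.exists_exact_schedule
  refine ⟨⟨fun q => PMF.pure (σ q), fun q τ hτ => ?_⟩, fun q τ hτ => ?_⟩
  · rw [PMF.mem_support_pure_iff] at hτ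
    exact hτ ▸ (hσ q).1
  · have hτ' : τ = σ q := (PMF.mem_support_pure_iff _ _).1 hτ
    subst hτ'
    exact ⟨hσ q, hback q⟩

/-- Every nonnegative rate vector is the mean of some arrival law with finite second moments. -/
theorem exists_arrivalLaw {lam : U → ℝ} (hlam : ∀ n, 0 ≤ lam n) :
    ∃ ν : U → PMF ℕ, FiniteSecondMoment ν ∧ arrivalRate ν = lam := by
  let μ : U → Measure ℕ := fun n => bernoulliMeasure (⌊lam n⌋₊ + 1) ⌊lam n⌋₊
    ⟨lam n - ⌊lam n⌋₊, sub_nonneg.2 (Nat.floor_le (hlam n)), by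
      linarith [Nat.lt_floor_add_one (lam n)]⟩
  refine ⟨fun n => (μ n).toPMF, fun n => ?_, funext fun n => ?_⟩
  · rw [Measure.toPMF_toMeasure]
    refine MemLp.of_bound (C := ((⌊lam n⌋₊ + 1 : ℕ) : ℝ))
      (Measurable.aestronglyMeasurable measurable_from_top) ?_
    have : ∀ᵐ k ∂(μ n), k ≤ ⌊lam n⌋₊ + 1 := by
      rw [ae_iff]
      simp [μ, bernoulliMeasure_def]
    filter_upwards [this] with k hk
    rw [Real.norm_of_nonneg (by positivity)]
    exact Nat.cast_le.2 hk
  · rw [arrivalRate, Measure.toPMF_toMeasure, integral_bernoulliMeasure]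
    simp
    ring

end CellNetwork

theorem mainTheorem6 {V U : Type*} [Fintype V] [DecidableEq V] [Fintype U] [DecidableEq U]
    (N : CellNetwork V U) :
    (∃ π : N.Policy, π.IsExactQ) ∧
    (∀ ν : U → PMF ℕ, CellNetwork.FiniteSecondMoment ν →
      CellNetwork.arrivalRate ν ∈ N.rateRegion →
      ∀ π : N.Policy, π.IsExactQ → IsPosRec (N.transition π ν)) ∧
    (∀ ν : U → PMF ℕ, CellNetwork.FiniteSecondMoment ν →
      CellNetwork.arrivalRate ν ∉ closure N.rateRegion →
      ∀ (π : N.Policy) (q : QueueState U), ¬ PosRecFrom (N.transition π ν) q) ∧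
    (∀ π : N.Policy, π.IsExactQ →
      N.rateRegion ⊆ N.stabilityRegion π ∧ N.stabilityRegion π ⊆ N.capacityRegion ∧
        N.capacityRegion ⊆ closure N.rateRegion) := by
  refine ⟨N.exists_isExactQ, fun ν hν hrate π hπ => hπ.isPosRec hν hrate,
    fun ν hν hrate π q h => hrate (CellNetwork.arrivalRate_mem_closure hν h),
    fun π hπ => ⟨fun lam hlam => ?_, Set.subset_iUnion N.stabilityRegion π,
      Set.iUnion_subset fun π' lam hlam => ?_⟩⟩
  · obtain ⟨ν, hν, rfl⟩ := CellNetwork.exists_arrivalLaw hlam.1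
    exact ⟨ν, hν, rfl, hπ.isPosRec hν hlam⟩
  · obtain ⟨ν, hν, rfl, hpos⟩ := hlam
    exact CellNetwork.arrivalRate_mem_closure hν (hpos 0)
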